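/- Let $S$ be a smooth surface over $\mathbb{C}$ (a separated scheme of finite type, smooth of relative dimension $2$ over $\mathbb{C}$), let $\theta \in H^0(S, \omega_S^{-1})$, regarded as an $\mathcal{O}_S$-linear map $\Theta : \omega_S = \Omega^2_S \to \mathcal{O}_S$ with associated Poisson bracket $\{f,g\}_\theta = \Theta(df\wedge dg)$, let $x \in S$ be a closed point, and let $\pi : S_x \to S$ be the blowup of $S$ at $x$. A Poisson structure on a $\mathbb{C}$-scheme is a skew-symmetric $\mathbb{C}$-bilinear bracket on its structure sheaf that is a derivation in each variable and satisfies the Jacobi identity. Then there is a Poisson structure $\{\cdot,\cdot\}$ on $S_x$ lifting $\theta$, that is, satisfying $\pi^*\{f,g\}_\theta = \{\pi^*f,\pi^*g\}$ for all open $U\subseteq S$ and all $f,g\in\mathcal{O}_S(U)$, if and only if $\theta(x)=0$ (the value of $\theta$ in the fibre of $\omega_S^{-1}$ at $x$ is zero). -/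

import Mathlib

open CategoryTheory AlgebraicGeometry TopologicalSpace
open scoped KaehlerDifferential

noncomputable section

namespace PoissonSurface

/-- The base `Spec ℂ`. -/
abbrev SpecC : Scheme.{0} := Spec (CommRingCat.of ℂ)

/-- The sections of the structure sheaf of a `ℂ`-scheme form a `ℂ`-algebra
through the structure morphism. -/
instance sectionsAlgebra (X : Scheme.{0}) [X.Over SpecC] (U : X.Opens) : Algebra ℂ Γ(X, U) :=
  ((Scheme.ΓSpecIso (CommRingCat.of ℂ)).inv ≫ (X ↘ SpecC).appLE ⊤ U le_top).hom.toAlgebra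

/-- Restriction `f ↦ f|_V` of functions from `U` to a smaller open set `V`. -/
def restrict {X : Scheme.{0}} {U V : X.Opens} (h : V ≤ U) : Γ(X, U) →+* Γ(X, V) :=
  (X.presheaf.map (homOfLE h).op).hom

/-- The `2`-form `df ∧ dg` on `U`. -/
def dWedge {X : Scheme.{0}} [X.Over SpecC] {U : X.Opens} (f g : Γ(X, U)) :
    ⋀[Γ(X, U)]^2 Ω[Γ(X, U)⁄ℂ] :=
  exteriorPower.ιMulti Γ(X, U) 2
    ![KaehlerDifferential.D ℂ Γ(X, U) f, KaehlerDifferential.D ℂ Γ(X, U) g]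

/-- A global section of the dual `ℋom(Ω²_X, 𝒪_X)` of the sheaf of `2`-forms: an `𝒪_X`-linear
map `Θ : Ω²_X → 𝒪_X`. Since `Ω²_X` is the sheafification of `U ↦ ⋀² Ω_{Γ(X, U)/ℂ}`, whose
sections over `U` are generated by the forms `df ∧ dg`, such a map is a family of
`Γ(X, U)`-linear maps `⋀² Ω_{Γ(X, U)/ℂ} → Γ(X, U)` that commutes with restriction.
On a smooth surface `Ω²_X = ω_X`, so this is an element of `H⁰(X, ω_X⁻¹)`. -/
structure AnticanonicalSection (X : Scheme.{0}) [X.Over SpecC] where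
  toLinearMap (U : X.Opens) : (⋀[Γ(X, U)]^2 Ω[Γ(X, U)⁄ℂ]) →ₗ[Γ(X, U)] Γ(X, U)
  restrict_apply {U V : X.Opens} (h : V ≤ U) (f g : Γ(X, U)) :
    toLinearMap V (dWedge (restrict h f) (restrict h g)) =
      restrict h (toLinearMap U (dWedge f g))

/-- The bracket `{f, g} = Θ(df ∧ dg)`. -/
def AnticanonicalSection.bracket {X : Scheme.{0}} [X.Over SpecC] (θ : AnticanonicalSection X)
    {U : X.Opens} (f g : Γ(X, U)) : Γ(X, U) :=
  θ.toLinearMap U (dWedge f g)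

/-- `θ(x) = 0`: for all local `2`-forms `α` at `x`, the function `Θ(α)` takes the value `0` in the
residue field of `x`. In other words the linear form `Θ(x)` on the fibre `Ω²_X ⊗ κ(x)`, that is,
the value of `θ` in the fibre of `(Ω²_X)^∨` at `x`, is zero. -/
def AnticanonicalSection.VanishesAt {X : Scheme.{0}} [X.Over SpecC] (θ : AnticanonicalSection X)
    (x : X) : Prop :=
  ∀ (U : X.Opens) (hx : x ∈ U) (α : ⋀[Γ(X, U)]^2 Ω[Γ(X, U)⁄ℂ]),
    X.evaluation U x hx (θ.toLinearMap U α) = 0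

/-- A Poisson structure on a `ℂ`-scheme: a skew `ℂ`-bilinear bracket on the structure sheaf that
is a derivation in each variable and satisfies the Jacobi identity. -/
structure PoissonStructure (X : Scheme.{0}) [X.Over SpecC] where
  bracket (U : X.Opens) : Γ(X, U) →ₗ[ℂ] Γ(X, U) →ₗ[ℂ] Γ(X, U)
  restrict_bracket {U V : X.Opens} (h : V ≤ U) (f g : Γ(X, U)) :
    restrict h (bracket U f g) = bracket V (restrict h f) (restrict h g)
  skew (U : X.Opens) (f g : Γ(X, U)) : bracket U f g = -bracket U g f
  leibniz_left (U : X.Opens) (f g h : Γ(X, U)) :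
    bracket U (f * g) h = f * bracket U g h + g * bracket U f h
  leibniz_right (U : X.Opens) (f g h : Γ(X, U)) :
    bracket U f (g * h) = g * bracket U f h + h * bracket U f g
  jacobi (U : X.Opens) (f g h : Γ(X, U)) :
    bracket U f (bracket U g h) + bracket U g (bracket U h f) + bracket U h (bracket U f g) = 0

/-- The Poisson structure `τ` on `Z` lifts `θ` along `π : Z ⟶ X`:
`π^*{f, g} = {π^* f, π^* g}` for all local functions `f`, `g` on `X`. -/
def IsLift {X Z : Scheme.{0}} [X.Over SpecC] [Z.Over SpecC] (π : Z ⟶ X)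
    (θ : AnticanonicalSection X) (τ : PoissonStructure Z) : Prop :=
  ∀ (U : X.Opens) (f g : Γ(X, U)),
    π.app U (θ.bracket f g) = τ.bracket (π ⁻¹ᵁ U) (π.app U f) (π.app U g)

/-- An ideal sheaf is invertible if it is locally generated by one nonzerodivisor, that is, if it
is the ideal sheaf of an effective Cartier divisor. -/
def IsInvertibleIdeal {X : Scheme.{0}} (I : X.IdealSheafData) : Prop :=
  ∀ x : X, ∃ U : X.affineOpens, x ∈ U.1 ∧
    ∃ a ∈ nonZeroDivisors Γ(X, U.1), I.ideal U = Ideal.span {a}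

/-- `π : Z ⟶ X` is the blowup of `X` along the ideal sheaf `I`: the inverse image ideal sheaf
`π⁻¹I · 𝒪_Z` is invertible, and every `g : W ⟶ X` whose inverse image ideal sheaf
`g⁻¹I · 𝒪_W` is invertible factors uniquely through `π`. -/
structure IsBlowup {X Z : Scheme.{0}} (I : X.IdealSheafData) (π : Z ⟶ X) : Prop where
  isInvertibleIdeal : IsInvertibleIdeal (I.comap π)
  existsUnique_lift : ∀ (W : Scheme.{0}) (g : W ⟶ X), IsInvertibleIdeal (I.comap g) →
    ∃! h : W ⟶ Z, h ≫ π = g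

/-- `π : Z ⟶ X` is the blowup of `X` at the closed point `x`, with its reduced structure. -/
def IsBlowupAt {X Z : Scheme.{0}} (x : X) (hx : IsClosed {x}) (π : Z ⟶ X) : Prop :=
  IsBlowup (Scheme.IdealSheafData.vanishingIdeal ⟨{x}, hx⟩) π

end PoissonSurface

end

/-! Let E be the exceptional divisor and t a local equation of it. If a lift exists, functions f, g
vanishing at x pull back to ta, tb, and {ta, tb} is again divisible by t because {t, t} = 0. Hence
{f, g} vanishes at the image x of E. Subtracting constants does not change brackets, and the forms
df ∧ dg span, so θ(x) = 0 (`vanishesAt_of_isLift`). This needs a point over x. One comes from a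
valuation ring dominating the local ring at x: the maximal ideal becomes principal and nonzero
there, so its spectrum maps to the blowup.

Conversely, the complement of x has a section s into the blowup Z, and pulling functions back along
s is injective because t is a nonzerodivisor. A lift is therefore determined by θ on the complement,
and every axiom can be checked there. The Jacobi identity holds there because in rank 2 a skew
triderivation is zero. It remains to see that brackets of functions on Z extend over E
(`exists_pull_eq_bracket`). Where a generates the ideal of E, functions on Z are locally fractions
of polynomials in w = b/a with coefficients c from S, and {c, w} = ({c, b} - w{c, a})/a. If θ(x) =
0, all brackets on S lie in the ideal of x, so they become divisible by a and no pole appears.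

The blowup is given only by its universal property; its charts are recovered by mapping the spectrum
of A[b/a] to it (`IsBlowup.exists_fraction`). -/

noncomputable section

namespace PoissonSurface

/-! ### Inverse images of ideal sheaves, test morphisms to a blowup, the ideal of a closed point -/

section

open Scheme

universe u

variable {X Y : Scheme.{u}}

/-- By the adjunction between `comap` and `map`, both ideals lie below the same ideals, and on an
affine scheme every ideal of global sections comes from an ideal sheaf. -/
theorem comap_ideal_top_of_isAffine [IsAffine X] [IsAffine Y] (f : X ⟶ Y)
    (I : Y.IdealSheafData) :
    (I.comap f).ideal ⟨⊤, isAffineOpen_top X⟩ =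
      (I.ideal ⟨⊤, isAffineOpen_top Y⟩).map f.appTop.hom := by
  have key : ∀ K : X.IdealSheafData, I.comap f ≤ K ↔
      (I.ideal ⟨⊤, isAffineOpen_top Y⟩).map f.appTop.hom ≤ K.ideal ⟨⊤, isAffineOpen_top X⟩ := by
    intro K
    rw [← Scheme.IdealSheafData.le_map_iff_comap_le, Ideal.map_le_iff_le_comap]
    have h := Scheme.IdealSheafData.ideal_map_of_isAffineHom K f ⟨⊤, isAffineOpen_top Y⟩
    change _ ↔ _ ≤ Ideal.comap (Scheme.Hom.app f ⊤).hom
      (K.ideal ⟨f ⁻¹ᵁ ⊤, _⟩)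
    rw [← h]
    exact ⟨fun h ↦ h _, fun h ↦ Scheme.IdealSheafData.le_of_isAffine h⟩
  apply le_antisymm
  · have := (key (Scheme.IdealSheafData.equivOfIsAffine.symm
      ((I.ideal ⟨⊤, isAffineOpen_top Y⟩).map f.appTop.hom))).2
    have h2 : ∀ J, (Scheme.IdealSheafData.equivOfIsAffine.symm J).ideal
        ⟨⊤, isAffineOpen_top X⟩ = J :=
      fun J ↦ (Scheme.IdealSheafData.equivOfIsAffine (X := X)).apply_symm_apply J
    rw [h2] at this
    refine (this le_rfl ⟨⊤, isAffineOpen_top X⟩).trans (h2 _).le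
  · exact (key _).1 le_rfl


theorem comap_ideal_opens_ι (I : Y.IdealSheafData) (U : Y.affineOpens) :
    letI : IsAffine U.1.toScheme := U.2
    (I.comap U.1.ι).ideal ⟨⊤, isAffineOpen_top U.1.toScheme⟩ =
      (I.ideal ⟨U.1.ι ''ᵁ ⊤, (isAffineOpen_top U.1.toScheme).image_of_isOpenImmersion U.1.ι⟩ :
        Ideal Γ(Y, U.1.ι ''ᵁ ⊤)) := by
  have : IsAffine U.1.toScheme := U.2
  have := Scheme.IdealSheafData.ideal_comap_of_isOpenImmersion I U.1.ι ⟨⊤, isAffineOpen_top U.1.toScheme⟩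
  rw [this]
  simp only [Scheme.Opens.ι_appIso]
  exact Ideal.comap_id _

/-- On affine opens the inverse image ideal sheaf is the extension of the ideal. -/
theorem comap_ideal_of_isAffineOpen (f : X ⟶ Y)
    (I : Y.IdealSheafData) (U : Y.affineOpens) (V : X.affineOpens) (e : V.1 ≤ f ⁻¹ᵁ U.1) :
    (I.comap f).ideal V = (I.ideal U).map (f.appLE U V e).hom := by
  have : IsAffine V.1.toScheme := V.2
  have : IsAffine U.1.toScheme := U.2
  have h1 := comap_ideal_top_of_isAffine (f.resLE U V e) (I.comap U.1.ι)
  rw [← Scheme.IdealSheafData.comap_comp, Scheme.Hom.resLE_comp_ι,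
    Scheme.IdealSheafData.comap_comp, comap_ideal_opens_ι, comap_ideal_opens_ι] at h1
  have h2 : (f.resLE U V e).appTop = f.appLE (U.1.ι ''ᵁ ⊤) (V.1.ι ''ᵁ ⊤) (by simpa using e) := by
    rw [Scheme.Hom.appTop, Scheme.Hom.app_eq_appLE]
    exact Scheme.Hom.resLE_appLE f e ⊤ ⊤ le_top
  rw [h2] at h1
  have key : ∀ (U' : Y.affineOpens) (V' : X.affineOpens) (e' : V'.1 ≤ f ⁻¹ᵁ U'.1), U' = U → V' = V →
    (I.comap f).ideal V' = (I.ideal U').map (f.appLE U' V' e').hom →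
    (I.comap f).ideal V = (I.ideal U).map (f.appLE U V e).hom := by
    rintro U' V' e' rfl rfl h; exact h
  exact key ⟨U.1.ι ''ᵁ ⊤, (isAffineOpen_top U.1.toScheme).image_of_isOpenImmersion U.1.ι⟩
    ⟨V.1.ι ''ᵁ ⊤, (isAffineOpen_top V.1.toScheme).image_of_isOpenImmersion V.1.ι⟩
    (by simpa using e) (Subtype.ext (by simp)) (Subtype.ext (by simp)) h1

theorem nonZeroDivisors_map_basicOpen {U : X.Opens} (hU : IsAffineOpen U) (f a : Γ(X, U))
    (ha : a ∈ nonZeroDivisors Γ(X, U)) :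
    X.presheaf.map (homOfLE (X.basicOpen_le f)).op a ∈ nonZeroDivisors Γ(X, X.basicOpen f) := by
  have := hU.isLocalization_basicOpen f
  exact IsLocalization.map_nonZeroDivisors_le (Submonoid.powers f) _ ⟨a, ha, rfl⟩

theorem IsInvertibleIdeal.exists_affine_le {X : Scheme.{0}} {I : X.IdealSheafData}
    (hI : IsInvertibleIdeal I) {x : X} {V : X.Opens} (hx : x ∈ V) :
    ∃ U : X.affineOpens, x ∈ U.1 ∧ U.1 ≤ V ∧
      ∃ a ∈ nonZeroDivisors Γ(X, U.1), I.ideal U = Ideal.span {a} := by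
  obtain ⟨U, hxU, a, ha, hIa⟩ := hI x
  obtain ⟨f, hfV, hxf⟩ := U.2.exists_basicOpen_le ⟨x, hx⟩ hxU
  refine ⟨X.affineBasicOpen f, hxf, hfV, _, nonZeroDivisors_map_basicOpen U.2 f a ha, ?_⟩
  rw [← I.map_ideal_basicOpen, hIa, Ideal.map_span, Set.image_singleton]
  rfl

theorem isInvertibleIdeal_top (X : Scheme.{0}) : IsInvertibleIdeal (⊤ : X.IdealSheafData) := by
  intro x
  obtain ⟨U, hU, hx, -⟩ := exists_isAffineOpen_mem_and_subset (x := x) (U := ⊤) trivial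
  exact ⟨⟨U, hU⟩, hx, 1, one_mem _, by rw [Ideal.span_singleton_one]; rfl⟩

/-- The inverse image is the unit ideal. So every morphism missing the centre factors uniquely
through the blowup. -/
theorem isInvertibleIdeal_comap_of_disjoint {X Y : Scheme.{0}} {I : Y.IdealSheafData} (f : X ⟶ Y)
    (h : ∀ x, f x ∉ I.support) : IsInvertibleIdeal (I.comap f) := by
  have : I.comap f = ⊤ := by
    rw [← IdealSheafData.support_eq_bot_iff, IdealSheafData.support_comap, ← SetLike.coe_set_eq]
    ext x
    simpa using h x
  rw [this]
  exact isInvertibleIdeal_top X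


theorem fromSpec_appLE_top {X : Scheme.{0}} {U : X.Opens} (hU : IsAffineOpen U)
    (e : (⊤ : (Spec Γ(X, U)).Opens) ≤ hU.fromSpec ⁻¹ᵁ U) :
    hU.fromSpec.appLE U ⊤ e = (Scheme.ΓSpecIso Γ(X, U)).inv := by
  rw [Hom.appLE, IsAffineOpen.fromSpec_app_self, Category.assoc, ← Functor.map_comp]
  exact (congrArg _ (CategoryTheory.Functor.map_id _ _)).trans (Category.comp_id _)

theorem comp_fromSpec_appLE_top {X : Scheme.{0}} {U : X.Opens} (hU : IsAffineOpen U)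
    {R : CommRingCat.{0}} (φ : Γ(X, U) ⟶ R)
    (e : (⊤ : (Spec R).Opens) ≤ (Spec.map φ ≫ hU.fromSpec) ⁻¹ᵁ U) :
    (Spec.map φ ≫ hU.fromSpec).appLE U ⊤ e = φ ≫ (Scheme.ΓSpecIso R).inv := by
  rw [← Scheme.Hom.appLE_comp_appLE (Spec.map φ) hU.fromSpec U ⊤ ⊤ hU.fromSpec_preimage_self.ge
    le_rfl, fromSpec_appLE_top, ΓSpecIso_inv_naturality]
  congr 1

/-- Source of affine test morphisms for the universal property: valuation rings, affine blowup
algebras and charts of the blowup itself. -/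
theorem isInvertibleIdeal_comap_Spec {Y : Scheme.{0}} {I : Y.IdealSheafData} (U : Y.affineOpens)
    {R : CommRingCat.{0}} (φ : Γ(Y, U.1) ⟶ R) {a : R} (ha : a ∈ nonZeroDivisors R)
    (h : (I.ideal U).map φ.hom = Ideal.span {a}) :
    IsInvertibleIdeal (I.comap (Spec.map φ ≫ U.2.fromSpec)) := by
  intro x
  have e : (⊤ : (Spec R).Opens) ≤ (Spec.map φ ≫ U.2.fromSpec) ⁻¹ᵁ U.1 := by
    rw [Hom.comp_preimage, U.2.fromSpec_preimage_self]
    exact le_rfl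
  refine ⟨⟨⊤, isAffineOpen_top _⟩, trivial, (Scheme.ΓSpecIso R).inv a, ?_, ?_⟩
  · exact (MulEquivClass.map_nonZeroDivisors
      (Scheme.ΓSpecIso R).symm.commRingCatIsoToRingEquiv).le ⟨a, ha, rfl⟩
  · rw [comap_ideal_of_isAffineOpen _ _ U _ e]
    have h' := comp_fromSpec_appLE_top U.2 φ e
    dsimp only
    rw [h', CommRingCat.hom_comp,
      ← Ideal.map_map, h, Ideal.map_span, Set.image_singleton]

theorem mem_vanishingIdeal_singleton_iff {X : Scheme.{0}} {x : X} (hx : IsClosed {x})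
    (U : X.affineOpens) (hxU : x ∈ U.1) (f : Γ(X, U.1)) :
    f ∈ (Scheme.IdealSheafData.vanishingIdeal ⟨{x}, hx⟩).ideal U ↔ x ∉ X.basicOpen f := by
  rw [Scheme.IdealSheafData.vanishingIdeal_ideal, PrimeSpectrum.mem_vanishingIdeal]
  have key : ∀ q : Spec Γ(X, U.1), f ∈ PrimeSpectrum.asIdeal q ↔ U.2.fromSpec q ∉ X.basicOpen f := by
    intro q
    change _ ↔ q ∉ U.2.fromSpec ⁻¹ᵁ X.basicOpen f
    have h := U.2.fromSpec_preimage_basicOpen f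
    refine Iff.trans ?_ (not_congr (SetLike.ext_iff.1 h q).symm)
    exact not_not.symm
  constructor
  · intro h
    obtain ⟨q, rfl⟩ : x ∈ Set.range U.2.fromSpec := by rwa [U.2.range_fromSpec]
    exact (key q).1 (h q rfl)
  · rintro h q (hq : _ = x)
    exact (key q).2 (hq ▸ h)

theorem support_vanishingIdeal_singleton {X : Scheme.{0}} {x : X} (hx : IsClosed {x}) (y : X) :
    y ∈ (Scheme.IdealSheafData.vanishingIdeal ⟨{x}, hx⟩).support ↔ y = x := by
  rw [← SetLike.mem_coe, Scheme.IdealSheafData.coe_support_vanishingIdeal]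
  rfl

theorem exists_mem_vanishingIdeal_singleton {X : Scheme.{0}} {x y : X} (hx : IsClosed {x})
    (U : X.affineOpens) (hyU : y ∈ U.1) (hxy : y ≠ x) :
    ∃ f ∈ (Scheme.IdealSheafData.vanishingIdeal ⟨{x}, hx⟩).ideal U, y ∈ X.basicOpen f := by
  have h := (support_vanishingIdeal_singleton hx y).not.2 hxy
  rw [Scheme.IdealSheafData.mem_support_iff_of_mem hyU, Scheme.mem_zeroLocus_iff] at h
  push Not at h
  exact h

theorem vanishingIdeal_singleton_ideal_of_notMem {X : Scheme.{0}} {x : X} (hx : IsClosed {x})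
    (U : X.affineOpens) (hxU : x ∉ U.1) :
    (Scheme.IdealSheafData.vanishingIdeal ⟨{x}, hx⟩).ideal U = ⊤ := by
  rw [Scheme.IdealSheafData.vanishingIdeal_ideal, Ideal.eq_top_iff_one,
    PrimeSpectrum.mem_vanishingIdeal]
  rintro q (hq : _ = x)
  exact absurd (hq ▸ (U.2.range_fromSpec ▸ Set.mem_range_self q : _ ∈ (U.1 : Set X))) hxU

end

/-! ### Local algebra: coordinates on a smooth surface and dominating valuation rings -/

section

open Scheme

section Algebra

variable {A : Type} [CommRing A] [Algebra ℂ A]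

/-- In a standard smooth presentation the differentials of the variables outside the range of
`P.map` form a basis, and the relative dimension counts them. -/
theorem exists_basis_kaehlerDifferential_eq_D [Nontrivial A]
    [Algebra.IsStandardSmoothOfRelativeDimension 2 ℂ A] :
    ∃ (b : Module.Basis (Fin 2) A Ω[A⁄ℂ]) (u : Fin 2 → A),
      ∀ i, b i = KaehlerDifferential.D ℂ A (u i) := by
  obtain ⟨ι, σ, _, _, P, hP⟩ :=
    Algebra.IsStandardSmoothOfRelativeDimension.out (n := 2) (R := ℂ) (S := A)
  classical
  have := Fintype.ofFinite ι
  have h1 : Nat.card ((Set.range P.map)ᶜ : Set ι) = 2 := by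
    have h2 := P.rank_kaehlerDifferential
    rw [hP, rank_eq_card_basis P.basisKaehler] at h2
    rw [Nat.card_eq_fintype_card]
    exact_mod_cast h2
  let e := Finite.equivFinOfCardEq h1
  exact ⟨P.basisKaehler.reindex e, fun i ↦ P.val (e.symm i), fun i ↦ by simp⟩

theorem derivation_eq_zero_of_basis {M : Type} [AddCommGroup M] [Module A M] [Module ℂ M]
    [IsScalarTower ℂ A M] (b : Module.Basis (Fin 2) A Ω[A⁄ℂ]) {u : Fin 2 → A}
    (hb : ∀ i, b i = KaehlerDifferential.D ℂ A (u i)) (d : Derivation ℂ A M)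
    (hd : ∀ i, d (u i) = 0) : d = 0 := by
  have : d.liftKaehlerDifferential = 0 := b.ext fun i ↦ by simp [hb, hd]
  rw [← d.liftKaehlerDifferential_comp, this]
  ext
  simp

theorem derivation_eq_zero_of_isLocalization {L : Type} [CommRing L] [Algebra ℂ L] [Algebra A L]
    [IsScalarTower ℂ A L] (N : Submonoid A) [IsLocalization N L]
    (b : Module.Basis (Fin 2) A Ω[A⁄ℂ]) {u : Fin 2 → A}
    (hb : ∀ i, b i = KaehlerDifferential.D ℂ A (u i)) (d : Derivation ℂ L L)
    (hd : ∀ i, d (algebraMap A L (u i)) = 0) : d = 0 := by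
  have h := derivation_eq_zero_of_basis b hb (d.compAlgebraMap A) hd
  have h' : ∀ a, d (algebraMap A L a) = 0 := fun a ↦ DFunLike.congr_fun h a
  ext y
  obtain ⟨⟨a, s⟩, has⟩ := IsLocalization.surj N y
  have h1 := congrArg d has
  rw [d.leibniz, h', h', smul_zero, zero_add, smul_eq_mul] at h1
  exact (IsLocalization.map_units L s).mul_right_eq_zero.1 h1

theorem exists_derivation_eq_one (b : Module.Basis (Fin 2) A Ω[A⁄ℂ]) {u : Fin 2 → A}
    (hb : ∀ i, b i = KaehlerDifferential.D ℂ A (u i)) (i : Fin 2) :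
    ∃ d : Derivation ℂ A A, d (u i) = 1 :=
  ⟨(b.coord i).compDer (KaehlerDifferential.D ℂ A), by
    change b.coord i (KaehlerDifferential.D ℂ A (u i)) = 1
    rw [← hb]; simp⟩

/-- Differentiating s uⁿ⁺¹ = 0 and multiplying by s gives (n + 1) s² uⁿ = 0. In characteristic zero
induction applies to s². -/
theorem isNilpotent_of_mul_pow_eq_zero {d : Derivation ℂ A A} {u : A} (hd : d u = 1) (n : ℕ) :
    ∀ s : A, s * u ^ n = 0 → IsNilpotent s := by
  induction n with
  | zero => intro s h; rw [pow_zero, mul_one] at h; exact h ▸ IsNilpotent.zero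
  | succ n ih =>
    intro s h
    have h1 := congrArg d h
    rw [map_zero, d.leibniz, d.leibniz_pow, hd, Nat.add_sub_cancel] at h1
    simp only [smul_eq_mul, mul_one, nsmul_eq_mul] at h1
    have h2 : ((n + 1 : ℕ) : A) * (s ^ 2 * u ^ n) = 0 := by
      linear_combination s * h1 - d s * h
    have h3 : IsUnit ((n + 1 : ℕ) : A) := by
      rw [← map_natCast (algebraMap ℂ A)]
      exact (IsUnit.mk0 _ (Nat.cast_ne_zero.2 n.succ_ne_zero)).map _
    exact IsNilpotent.of_pow (ih (s ^ 2) (h3.mul_right_eq_zero.1 h2))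

/-- Modulo the square of the maximal ideal, a ↦ a - ε(a) is a derivation. After also dividing by the
centred coordinates it kills both coordinates, hence is zero. -/
theorem ker_le_span_sup_sq (ε : A →ₐ[ℂ] ℂ) (b : Module.Basis (Fin 2) A Ω[A⁄ℂ]) {u : Fin 2 → A}
    (hb : ∀ i, b i = KaehlerDifferential.D ℂ A (u i)) :
    RingHom.ker ε ≤ Ideal.span (Set.range fun i ↦ u i - algebraMap ℂ A (ε (u i))) ⊔
      RingHom.ker ε • RingHom.ker ε := by
  set J := Ideal.span (Set.range fun i ↦ u i - algebraMap ℂ A (ε (u i))) ⊔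
      RingHom.ker ε • RingHom.ker ε with hJ
  have hm : ∀ a, a - algebraMap ℂ A (ε a) ∈ RingHom.ker ε := by
    intro a
    simp [RingHom.mem_ker]
  let d : Derivation ℂ A (A ⧸ J) := Derivation.mk'
    ((Ideal.Quotient.mkₐ ℂ J).toLinearMap ∘ₗ
      (LinearMap.id - (Algebra.linearMap ℂ A) ∘ₗ ε.toLinearMap)) <| by
    intro a c
    change Ideal.Quotient.mk J _ = a • Ideal.Quotient.mk J _ + c • Ideal.Quotient.mk J _
    rw [Algebra.smul_def, Algebra.smul_def, Ideal.Quotient.algebraMap_eq, ← map_mul, ← map_mul,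
      ← map_add, Ideal.Quotient.mk_eq_mk_iff_sub_mem]
    have h1 : (a - algebraMap ℂ A (ε a)) * (c - algebraMap ℂ A (ε c)) ∈ J :=
      (le_sup_right : _ ≤ J) (Ideal.mul_mem_mul (hm a) (hm c))
    rw [← neg_mem_iff] at h1
    convert! h1 using 1
    simp
    ring
  have hd : d = 0 := by
    refine derivation_eq_zero_of_basis b hb d fun i ↦ ?_
    exact Ideal.Quotient.eq_zero_iff_mem.2
      ((le_sup_left : _ ≤ J) (Ideal.subset_span ⟨i, rfl⟩))
  intro a ha
  have h1 : Ideal.Quotient.mk J (a - algebraMap ℂ A (ε a)) = 0 := DFunLike.congr_fun hd a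
  rw [(RingHom.mem_ker).1 ha, map_zero, sub_zero] at h1
  exact Ideal.Quotient.eq_zero_iff_mem.1 h1

/-- Nakayama: the centred coordinates generate the maximal ideal once r is inverted. -/
theorem exists_notMem_mul_mem_span [IsNoetherianRing A] (ε : A →ₐ[ℂ] ℂ)
    (b : Module.Basis (Fin 2) A Ω[A⁄ℂ]) {u : Fin 2 → A}
    (hb : ∀ i, b i = KaehlerDifferential.D ℂ A (u i)) :
    ∃ r, ε r ≠ 0 ∧ ∀ a, ε a = 0 →
      r * a ∈ Ideal.span (Set.range fun i ↦ u i - algebraMap ℂ A (ε (u i))) := by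
  have hprime : (RingHom.ker ε) ≠ ⊤ := RingHom.ker_ne_top _
  obtain ⟨r, hr, hle⟩ := Submodule.exists_sub_one_mem_and_smul_le_of_fg_of_le_sup
    (IsNoetherian.noetherian (RingHom.ker ε)) le_rfl (ker_le_span_sup_sq ε b hb)
  refine ⟨r, ?_, fun a ha ↦ hle (Submodule.smul_mem_pointwise_smul a r _ ha)⟩
  rw [RingHom.mem_ker, map_sub, map_one, sub_eq_zero] at hr
  rw [hr]
  exact one_ne_zero

theorem exists_algHom_ker_eq [Algebra.FiniteType ℂ A] (m : Ideal A) [m.IsMaximal] :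
    ∃ ε : A →ₐ[ℂ] ℂ, RingHom.ker ε = m := by
  let : Field (A ⧸ m) := Ideal.Quotient.field m
  have : Module.Finite ℂ (A ⧸ m) := finite_of_finite_type_of_isJacobsonRing ℂ (A ⧸ m)
  have hb : Function.Bijective (algebraMap ℂ (A ⧸ m)) :=
    IsAlgClosed.algebraMap_bijective_of_isIntegral
  let e := AlgEquiv.ofBijective (Algebra.ofId ℂ (A ⧸ m)) hb
  refine ⟨(e.symm : (A ⧸ m) →ₐ[ℂ] ℂ).comp (Ideal.Quotient.mkₐ ℂ m), ?_⟩
  ext a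
  simp [RingHom.mem_ker, Ideal.Quotient.eq_zero_iff_mem]

end Algebra

/-- Take a prime p ⊆ m avoiding u and a valuation ring of Frac(A/p) dominating the image of the
localization at m. Finitely generated ideals of a valuation ring are principal, and the extension of
m is nonzero because u ∉ p. -/
theorem exists_valuationSubring {A : Type} [CommRing A] (m : Ideal A) [hm : m.IsPrime]
    (hfg : m.FG) {u : A} (hu : u ∈ m) (h : ∀ s ∉ m, ∀ n : ℕ, s * u ^ n ≠ 0) :
    ∃ (K : Type) (_ : Field K) (V : ValuationSubring K) (φ : A →+* V) (a : V),
      a ≠ 0 ∧ (IsLocalRing.maximalIdeal V).comap φ = m ∧ m.map φ = Ideal.span {a} := by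
  obtain ⟨p, hp, hmp, hdisj⟩ : ∃ p : Ideal A, p.IsPrime ∧ p ≤ m ∧ u ∉ p := by
    -- Avoiding the monoid generated by u and the complement of m forces both p ⊆ m and u ∉ p.
    obtain ⟨p, hp, -, hd⟩ := Ideal.exists_le_prime_disjoint (⊥ : Ideal A)
      (m.primeCompl ⊔ Submonoid.powers u) (by
        rw [Set.disjoint_left]
        rintro _ (rfl : _ = (0 : A)) h0
        obtain ⟨s, hs, _, ⟨n, rfl⟩, hsn⟩ := Submonoid.mem_sup.1 h0
        exact h s hs n hsn)
    rw [Set.disjoint_left] at hd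
    refine ⟨p, hp, fun x hx ↦ ?_, fun hup ↦ hd hup ((le_sup_right : _ ≤ m.primeCompl ⊔ _)
      (Submonoid.mem_powers u))⟩
    by_contra hxm
    exact hd hx ((le_sup_left : m.primeCompl ≤ _) hxm)
  let K := FractionRing (A ⧸ p)
  let f : A →+* K := (algebraMap (A ⧸ p) K).comp (Ideal.Quotient.mk p)
  have hf : ∀ x, f x = 0 ↔ x ∈ p := fun x ↦ by
    simp only [f, RingHom.comp_apply]
    rw [FaithfulSMul.algebraMap_eq_zero_iff, Ideal.Quotient.eq_zero_iff_mem]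
  let g : Localization.AtPrime m →+* K := IsLocalization.lift (M := m.primeCompl) (g := f)
    fun y ↦ IsUnit.mk0 _ (mt (hf _).1 fun hy ↦ y.2 (hmp hy))
  obtain ⟨V, hV, hloc⟩ := IsLocalRing.exists_factor_valuationRing g
  let ψ : Localization.AtPrime m →+* V := g.codRestrict V.toSubring hV
  have : IsLocalHom ψ := hloc
  let φ : A →+* V := ψ.comp (algebraMap A _)
  have hφ : ∀ x, ((φ x : V) : K) = f x := fun x ↦ IsLocalization.lift_eq _ x
  have hprin : (m.map φ).IsPrincipal := by
    have : (m.map φ).FG := hfg.map φ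
    exact IsBezout.isPrincipal_of_FG _ this
  obtain ⟨a, ha⟩ := hprin
  refine ⟨K, inferInstance, V, φ, a, ?_, ?_, ha⟩
  · rintro rfl
    have h1 : φ u ∈ m.map φ := Ideal.mem_map_of_mem _ hu
    rw [ha] at h1
    have h2 : φ u = 0 := by simpa using h1
    exact hdisj ((hf u).1 (by rw [← hφ, h2]; rfl))
  · have h1 : (IsLocalRing.maximalIdeal V).comap ψ = IsLocalRing.maximalIdeal _ :=
      ((IsLocalRing.local_hom_TFAE ψ).out 0 4).1 hloc
    rw [← Ideal.comap_comap, h1]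
    exact Localization.AtPrime.under_maximalIdeal

end

/-! ### The bracket of θ and its Jacobi identity -/

section

open Scheme

theorem eq_zero_of_eq_neg {M : Type} [AddCommGroup M] [Module ℂ M] {a : M} (h : a = -a) :
    a = 0 := by
  have h2 : (2 : ℂ) • a = 0 := by rw [two_smul]; nth_rewrite 1 [h]; exact neg_add_cancel a
  exact (smul_eq_zero.1 h2).resolve_left two_ne_zero

/-- The second-order terms of the Jacobiator cancel by skewness, so it is an alternating derivation
in each slot and is determined by its values on u 0 and u 1. Among three arguments from two
coordinates, two coincide. -/
theorem jacobi_of_derivation_eq_zero {L : Type} [CommRing L] [Algebra ℂ L]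
    (B : L →ₗ[ℂ] L →ₗ[ℂ] L) (skew : ∀ f g, B f g = -B g f)
    (leibniz : ∀ f g h, B f (g * h) = g * B f h + h * B f g) (u : Fin 2 → L)
    (H : ∀ d : Derivation ℂ L L, (∀ i, d (u i) = 0) → d = 0) (f g h : L) :
    B f (B g h) + B g (B h f) + B h (B f g) = 0 := by
  let J : L → L → L → L := fun f g h ↦ B f (B g h) + B g (B h f) + B h (B f g)
  have cyc : ∀ f g h, J f g h = J g h f := fun f g h ↦ by simp only [J]; ring
  have swap : ∀ f g h, J f g h = -J g f h := fun f g h ↦ by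
    simp only [J]
    rw [skew g h, skew h f, skew f g]
    simp only [map_neg]
    ring
  have diag : ∀ f h, J f f h = 0 := fun f h ↦ eq_zero_of_eq_neg (swap f f h)
  have leibniz' : ∀ f g h, B (f * g) h = f * B g h + g * B f h := fun f g h ↦ by
    rw [skew, leibniz, skew h g, skew h f]; ring
  let d (g h : L) : Derivation ℂ L L := Derivation.mk'
    (B.flip (B g h) + B g ∘ₗ B h + B h ∘ₗ B.flip g) <| by
      intro a c
      simp only [LinearMap.add_apply, LinearMap.comp_apply, LinearMap.flip_apply, smul_eq_mul,
        leibniz, leibniz', map_add]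
      rw [skew h a, skew h c, skew g a, skew g c]
      simp only [map_neg]
      ring
  have hd : ∀ f g h, d g h f = J f g h := fun _ _ _ ↦ rfl
  have vanish : ∀ g h, (∀ i, J (u i) g h = 0) → ∀ f, J f g h = 0 := fun g h hi f ↦ by
    rw [← hd, H (d g h) hi]; rfl
  have h0 : ∀ i j k, J (u i) (u j) (u k) = 0 := by
    intro i j k
    have : i = j ∨ j = k ∨ k = i := by omega
    rcases this with rfl | rfl | rfl
    · exact diag _ _
    · rw [cyc, diag]
    · rw [← cyc, diag]
  have h1 : ∀ f j k, J f (u j) (u k) = 0 := fun f j k ↦ vanish _ _ (fun i ↦ h0 i j k) f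
  have h2 : ∀ f g k, J f g (u k) = 0 := fun f g k ↦ vanish _ _ (fun i ↦ by
    rw [cyc, h1]) f
  exact vanish _ _ (fun i ↦ by rw [cyc, h2]) f

variable {X : Scheme.{0}} [X.Over SpecC]

theorem algebraMap_apply' (U : X.Opens) (c : ℂ) : algebraMap ℂ Γ(X, U) c =
    (X ↘ SpecC).appLE ⊤ U le_top ((Scheme.ΓSpecIso (CommRingCat.of ℂ)).inv c) := rfl

theorem appLE_algebraMap {Y : Scheme.{0}} [Y.Over SpecC] (f : X ⟶ Y) [f.IsOver SpecC]
    (U : Y.Opens) (V : X.Opens) (e : V ≤ f ⁻¹ᵁ U) (c : ℂ) :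
    f.appLE U V e (algebraMap ℂ Γ(Y, U) c) = algebraMap ℂ Γ(X, V) c := by
  rw [algebraMap_apply', algebraMap_apply']
  have h := Scheme.Hom.appLE_comp_appLE f (Y ↘ SpecC) ⊤ U V le_top e
  have h2 := comp_over f SpecC
  simp only [h2] at h
  rw [← h]
  rfl

theorem restrict_algebraMap {U V : X.Opens} (h : V ≤ U) (c : ℂ) :
    restrict h (algebraMap ℂ Γ(X, U) c) = algebraMap ℂ Γ(X, V) c := by
  rw [algebraMap_apply', algebraMap_apply',
    ← Scheme.Hom.appLE_map (X ↘ SpecC) (U := ⊤) (V := U) le_top (homOfLE h).op]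
  rfl

theorem restrict_restrict {X : Scheme.{0}} {U V W : X.Opens} (h : V ≤ U) (h' : W ≤ V) (f : Γ(X, U)) :
    restrict h' (restrict h f) = restrict (h'.trans h) f := by
  change (X.presheaf.map _ ≫ X.presheaf.map _) f = _
  rw [← Functor.map_comp]
  rfl

section dWedge

variable {U : X.Opens}

theorem dWedge_swap (f g : Γ(X, U)) : dWedge f g = -dWedge g f := by
  rw [dWedge, dWedge, ← AlternatingMap.map_swap _ _ (i := 0) (j := 1) (by decide)]
  congr 1
  ext i
  fin_cases i <;> rfl

theorem dWedge_add_left (f f' g : Γ(X, U)) : dWedge (f + f') g = dWedge f g + dWedge f' g := by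
  rw [dWedge, map_add]
  exact AlternatingMap.map_vecCons_add _ _ _ _

theorem dWedge_smul_left (c : ℂ) (f g : Γ(X, U)) : dWedge (c • f) g = c • dWedge f g := by
  rw [dWedge, Derivation.map_smul, ← algebraMap_smul Γ(X, U) c, ← algebraMap_smul Γ(X, U) c]
  exact AlternatingMap.map_vecCons_smul _ _ _ _

theorem dWedge_mul_left (f f' g : Γ(X, U)) :
    dWedge (f * f') g = f • dWedge f' g + f' • dWedge f g := by
  rw [dWedge, Derivation.leibniz]
  refine (AlternatingMap.map_vecCons_add _ _ _ _).trans ?_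
  congr 1 <;> exact AlternatingMap.map_vecCons_smul _ _ _ _

end dWedge

namespace AnticanonicalSection

variable (θ : AnticanonicalSection X) {U V : X.Opens}

theorem bracket_skew (f g : Γ(X, U)) : θ.bracket f g = -θ.bracket g f := by
  rw [bracket, dWedge_swap, map_neg]; rfl

theorem bracket_add_left (f f' g : Γ(X, U)) :
    θ.bracket (f + f') g = θ.bracket f g + θ.bracket f' g := by
  rw [bracket, dWedge_add_left, map_add]; rfl

theorem bracket_smul_left (c : ℂ) (f g : Γ(X, U)) :
    θ.bracket (c • f) g = c • θ.bracket f g := by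
  rw [bracket, dWedge_smul_left, ← algebraMap_smul Γ(X, U) c, map_smul,
    ← algebraMap_smul Γ(X, U) c]; rfl

theorem bracket_mul_left (f f' g : Γ(X, U)) :
    θ.bracket (f * f') g = f * θ.bracket f' g + f' * θ.bracket f g := by
  rw [bracket, dWedge_mul_left, map_add, map_smul, map_smul]; rfl

theorem bracket_mul_right (f g g' : Γ(X, U)) :
    θ.bracket f (g * g') = g * θ.bracket f g' + g' * θ.bracket f g := by
  rw [bracket_skew, bracket_mul_left, bracket_skew θ g', bracket_skew θ g]
  ring

theorem restrict_bracket (h : V ≤ U) (f g : Γ(X, U)) :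
    restrict h (θ.bracket f g) = θ.bracket (restrict h f) (restrict h g) :=
  (θ.restrict_apply h f g).symm

/-- The bracket as a bilinear map. -/
def bilinear (U : X.Opens) : Γ(X, U) →ₗ[ℂ] Γ(X, U) →ₗ[ℂ] Γ(X, U) :=
  LinearMap.mk₂ ℂ θ.bracket θ.bracket_add_left θ.bracket_smul_left
    (fun f g g' ↦ by
      rw [bracket_skew, bracket_add_left, neg_add, ← bracket_skew, ← bracket_skew])
    (fun c f g ↦ by rw [bracket_skew, bracket_smul_left, ← smul_neg, ← bracket_skew])

@[simp]
theorem bilinear_apply (f g : Γ(X, U)) : θ.bilinear U f g = θ.bracket f g := rfl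

end AnticanonicalSection

theorem exists_affine_isStandardSmooth [SmoothOfRelativeDimension 2 (X ↘ SpecC)] (x : X) :
    ∃ V : X.affineOpens, x ∈ V.1 ∧ Algebra.IsStandardSmoothOfRelativeDimension 2 ℂ Γ(X, V.1) := by
  obtain ⟨U, hU, V, hV, hx, e, h⟩ :=
    SmoothOfRelativeDimension.exists_isStandardSmoothOfRelativeDimension
      (n := 2) (f := X ↘ SpecC) x
  refine ⟨⟨V, hV⟩, hx, ?_⟩
  have hsub : Subsingleton SpecC := inferInstanceAs (Subsingleton (PrimeSpectrum ℂ))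
  -- The base is a single point.
  obtain rfl : U = ⊤ := by
    rw [eq_top_iff]
    intro y _
    rw [Subsingleton.elim y ((X ↘ SpecC) x)]
    exact e hx
  change RingHom.IsStandardSmoothOfRelativeDimension 2
    (((X ↘ SpecC).appLE ⊤ V e).hom.comp (Scheme.ΓSpecIso (CommRingCat.of ℂ)).inv.hom)
  exact RingHom.isStandardSmoothOfRelativeDimension_respectsIso.2 _
    (Scheme.ΓSpecIso (CommRingCat.of ℂ)).symm.commRingCatIsoToRingEquiv h

theorem exists_basis_kaehlerDifferential_sections [SmoothOfRelativeDimension 2 (X ↘ SpecC)]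
    (x : X) : ∃ V : X.affineOpens, x ∈ V.1 ∧ Algebra.FiniteType ℂ Γ(X, V.1) ∧
      ∃ (b : Module.Basis (Fin 2) Γ(X, V.1) Ω[Γ(X, V.1)⁄ℂ]) (u : Fin 2 → Γ(X, V.1)),
        ∀ i, b i = KaehlerDifferential.D ℂ Γ(X, V.1) (u i) := by
  obtain ⟨V, hx, h⟩ := exists_affine_isStandardSmooth x
  have : Nonempty V.1 := ⟨⟨x, hx⟩⟩
  have := Algebra.IsStandardSmoothOfRelativeDimension.isStandardSmooth 2 (R := ℂ) (S := Γ(X, V.1))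
  exact ⟨V, hx, inferInstance, exists_basis_kaehlerDifferential_eq_D⟩

theorem eq_of_locally_eq' {X : Scheme.{0}} {U : X.Opens} (f g : Γ(X, U))
    (h : ∀ x ∈ U, ∃ (V : X.Opens) (hV : V ≤ U), x ∈ V ∧ restrict hV f = restrict hV g) :
    f = g := by
  choose V hV hx h using h
  exact X.sheaf.eq_of_locally_eq' (fun x : U ↦ V x.1 x.2) U (fun x ↦ homOfLE (hV x.1 x.2))
    (fun x hxU ↦ Opens.mem_iSup.2 ⟨⟨x, hxU⟩, hx x hxU⟩) f g fun x ↦ h x.1 x.2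

/-- On a smooth surface every bivector field satisfies the Jacobi identity. -/
theorem AnticanonicalSection.jacobi [SmoothOfRelativeDimension 2 (X ↘ SpecC)]
    (θ : AnticanonicalSection X) {U : X.Opens} (f g h : Γ(X, U)) :
    θ.bracket f (θ.bracket g h) + θ.bracket g (θ.bracket h f) + θ.bracket h (θ.bracket f g) = 0 := by
  refine eq_of_locally_eq' _ _ fun x hxU ↦ ?_
  obtain ⟨V, hxV, -, b, u, hb⟩ := exists_basis_kaehlerDifferential_sections x
  obtain ⟨r, hr, hxr⟩ := V.2.exists_basicOpen_le ⟨x, hxU⟩ hxV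
  refine ⟨X.basicOpen r, hr, hxr, ?_⟩
  simp only [map_add, map_zero, restrict_bracket]
  have hloc : IsLocalization.Away r Γ(X, X.basicOpen r) := V.2.isLocalization_basicOpen r
  have htower : IsScalarTower ℂ Γ(X, V.1) Γ(X, X.basicOpen r) :=
    IsScalarTower.of_algebraMap_eq fun c ↦ (restrict_algebraMap (X.basicOpen_le r) c).symm
  exact jacobi_of_derivation_eq_zero (θ.bilinear _) θ.bracket_skew θ.bracket_mul_right
    (fun i ↦ algebraMap Γ(X, V.1) _ (u i))
    (fun d hd ↦ derivation_eq_zero_of_isLocalization (Submonoid.powers r) b hb d hd) _ _ _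

end

/-! ### A lift forces θ to vanish at x -/

section

open Scheme

theorem exists_affineOpens_mem_le {X : Scheme.{0}} {x : X} {U : X.Opens} (hx : x ∈ U) :
    ∃ W : X.affineOpens, x ∈ W.1 ∧ W.1 ≤ U := by
  obtain ⟨W, hW, hxW, hWU⟩ := exists_isAffineOpen_mem_and_subset hx
  exact ⟨⟨W, hW⟩, hxW, hWU⟩

theorem exists_vanishingIdeal_ideal_eq_asIdeal {X : Scheme.{0}} {x : X} (hx : IsClosed {x})
    (U : X.affineOpens) (hxU : x ∈ U.1) :
    ∃ q : PrimeSpectrum Γ(X, U.1), U.2.fromSpec q = x ∧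
      (IdealSheafData.vanishingIdeal ⟨{x}, hx⟩).ideal U = q.asIdeal ∧ q.asIdeal.IsMaximal := by
  obtain ⟨q, hq⟩ : x ∈ Set.range U.2.fromSpec := by rwa [U.2.range_fromSpec]
  have h : U.2.fromSpec ⁻¹' {x} = ({q} : Set (PrimeSpectrum Γ(X, U.1))) := by
    rw [← hq]
    rw [← Set.image_singleton]
    have := IsAffineOpen.isOpenImmersion_fromSpec U.2
    exact Set.preimage_image_eq {q} U.2.fromSpec.isOpenEmbedding.injective
  refine ⟨q, hq, ?_, ?_⟩
  · rw [IdealSheafData.vanishingIdeal_ideal]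
    exact (congrArg _ h).trans (PrimeSpectrum.vanishingIdeal_singleton q)
  · refine (PrimeSpectrum.isClosed_singleton_iff_isMaximal q).1 ?_
    exact h ▸ hx.preimage U.2.fromSpec.continuous

variable {S : Scheme.{0}} [S.Over SpecC] [SmoothOfRelativeDimension 2 (S ↘ SpecC)]

theorem finiteType_sections (U : S.affineOpens) : Algebra.FiniteType ℂ Γ(S, U.1) := by
  have := SmoothOfRelativeDimension.smooth 2 (S ↘ SpecC)
  have h : ((S ↘ SpecC).appLE ⊤ U.1 le_top).hom.FiniteType :=
    HasRingHomProperty.appLE @LocallyOfFiniteType (S ↘ SpecC) inferInstance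
      ⟨⊤, isAffineOpen_top _⟩ U le_top
  exact RingHom.finiteType_respectsIso.2 _
    (Scheme.ΓSpecIso (CommRingCat.of ℂ)).symm.commRingCatIsoToRingEquiv h

variable {x : S} (hx : IsClosed {x})

theorem exists_algHom_ker_eq_vanishingIdeal (U : S.affineOpens) (hxU : x ∈ U.1) :
    ∃ ε : Γ(S, U.1) →ₐ[ℂ] ℂ,
      RingHom.ker ε = (IdealSheafData.vanishingIdeal ⟨{x}, hx⟩).ideal U := by
  obtain ⟨q, -, h, hm⟩ := exists_vanishingIdeal_ideal_eq_asIdeal hx U hxU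
  have := finiteType_sections U
  rw [h]
  exact exists_algHom_ker_eq q.asIdeal

/-- The generators are coordinates minus their values at x, on the basic open set where the element
r from Nakayama's lemma is invertible. -/
theorem exists_vanishingIdeal_eq_span_of_mem :
    ∃ (U : S.affineOpens) (u : Fin 2 → Γ(S, U.1)), x ∈ U.1 ∧
      (IdealSheafData.vanishingIdeal ⟨{x}, hx⟩).ideal U = Ideal.span (Set.range u) := by
  obtain ⟨V, hxV, hft, b, u, hb⟩ := exists_basis_kaehlerDifferential_sections x
  obtain ⟨ε, hε⟩ := exists_algHom_ker_eq_vanishingIdeal hx V hxV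
  have : IsNoetherianRing Γ(S, V.1) := Algebra.FiniteType.isNoetherianRing ℂ _
  obtain ⟨r, hr, hspan⟩ := exists_notMem_mul_mem_span ε b hb
  have hmem : ∀ a, ε a = 0 ↔ a ∈ (IdealSheafData.vanishingIdeal ⟨{x}, hx⟩).ideal V :=
    fun a ↦ by rw [← hε]; rfl
  have hxr : x ∈ S.basicOpen r := by
    rw [Ne, hmem, mem_vanishingIdeal_singleton_iff hx V hxV] at hr
    exact not_not.1 hr
  refine ⟨S.affineBasicOpen r, fun i ↦ restrict (S.basicOpen_le r)
    (u i - algebraMap ℂ _ (ε (u i))), hxr, ?_⟩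
  have hr' : IsUnit (restrict (S.basicOpen_le r) r) :=
    RingedSpace.isUnit_res_basicOpen S.toRingedSpace r
  have himage : Ideal.span (Set.range fun i ↦ restrict (S.basicOpen_le r)
      (u i - algebraMap ℂ _ (ε (u i)))) =
      (Ideal.span (Set.range fun i ↦ u i - algebraMap ℂ _ (ε (u i)))).map
        (restrict (S.basicOpen_le r)) := by
    rw [Ideal.map_span, ← Set.range_comp]
    rfl
  refine (IdealSheafData.map_ideal_basicOpen _ V r).symm.trans (Eq.trans ?_ himage.symm)
  apply le_antisymm
  · rw [Ideal.map_le_iff_le_comap]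
    intro a ha
    have h1 := Ideal.mem_map_of_mem (restrict (S.basicOpen_le r)) (hspan a ((hmem a).2 ha))
    rw [map_mul, Ideal.unit_mul_mem_iff_mem _ hr'] at h1
    exact h1
  · refine Ideal.map_mono (Ideal.span_le.2 ?_)
    rintro _ ⟨i, rfl⟩
    exact (hmem _).1 (by simp)

theorem exists_vanishingIdeal_eq_span (y : S) :
    ∃ (U : S.affineOpens) (u : Fin 2 → Γ(S, U.1)), y ∈ U.1 ∧
      (IdealSheafData.vanishingIdeal ⟨{x}, hx⟩).ideal U = Ideal.span (Set.range u) := by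
  by_cases h : y = x
  · rw [h]
    exact exists_vanishingIdeal_eq_span_of_mem hx
  · obtain ⟨U, hU, hyU, hUx⟩ := exists_isAffineOpen_mem_and_subset (x := y)
      (U := ⟨{x}ᶜ, hx.isOpen_compl⟩) h
    refine ⟨⟨U, hU⟩, fun _ ↦ 1, hyU, ?_⟩
    rw [vanishingIdeal_singleton_ideal_of_notMem hx ⟨U, hU⟩ fun h ↦ hUx h rfl, Set.range_const,
      Ideal.span_singleton_one]

/-- The exceptional fibre of the blowup of a smooth surface at a closed point is nonempty. -/
theorem IsBlowupAt.exists_apply_eq {Z : Scheme.{0}} {π : Z ⟶ S} (hπ : IsBlowupAt x hx π) :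
    ∃ z, π z = x := by
  obtain ⟨V, hxV, hft, b, u, hb⟩ := exists_basis_kaehlerDifferential_sections x
  obtain ⟨ε, hε⟩ := exists_algHom_ker_eq_vanishingIdeal hx V hxV
  obtain ⟨q, hqx, hq, -⟩ := exists_vanishingIdeal_ideal_eq_asIdeal hx V hxV
  have : IsNoetherianRing Γ(S, V.1) := Algebra.FiniteType.isNoetherianRing ℂ _
  obtain ⟨d, hd⟩ := exists_derivation_eq_one b hb 0
  have hd' : d (u 0 - algebraMap ℂ _ (ε (u 0))) = 1 := by
    rw [map_sub, hd, d.map_algebraMap, sub_zero]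
  -- The chosen element is a coordinate vanishing at x. If s times a power of it were zero, s would
  -- be nilpotent and hence lie in the prime of x.
  obtain ⟨K, _, W, φ, a, ha, hφ, hspan⟩ := exists_valuationSubring q.asIdeal
    (IsNoetherian.noetherian _) (u := u 0 - algebraMap ℂ _ (ε (u 0)))
    (by rw [← hq, ← hε]; simp [RingHom.mem_ker])
    (fun s hs n h ↦ hs (by
      obtain ⟨k, hk⟩ := isNilpotent_of_mul_pow_eq_zero hd' n s h
      exact q.2.mem_of_pow_mem k (hk ▸ zero_mem _)))
  obtain ⟨h, hh, -⟩ := hπ.existsUnique_lift _ _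
    (isInvertibleIdeal_comap_Spec V (R := CommRingCat.of W) (CommRingCat.ofHom φ) (a := a)
      (mem_nonZeroDivisors_of_ne_zero ha) (by rw [hq]; exact hspan))
  refine ⟨h (IsLocalRing.closedPoint W), ?_⟩
  refine (Scheme.Hom.comp_apply h π _).symm.trans ?_
  rw [hh, ← hqx]
  refine (Scheme.Hom.comp_apply _ _ _).trans (congrArg _ ?_)
  exact PrimeSpectrum.ext hφ

/-- In the Leibniz expansion of {ta, tb} the only term without a factor t is ab{t, t}, which is
zero. -/
theorem bracket_mul_mem_span {Z : Scheme.{0}} [Z.Over SpecC] (τ : PoissonStructure Z)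
    {V : Z.Opens} {t f g : Γ(Z, V)} (hf : f ∈ Ideal.span {t}) (hg : g ∈ Ideal.span {t}) :
    τ.bracket V f g ∈ Ideal.span {t} := by
  rw [Ideal.mem_span_singleton] at *
  obtain ⟨a, rfl⟩ := hf
  obtain ⟨b, rfl⟩ := hg
  have h : τ.bracket V t t = 0 := eq_zero_of_eq_neg (τ.skew V t t)
  rw [τ.leibniz_left, τ.leibniz_right, τ.leibniz_right, h]
  exact ⟨a * τ.bracket V t b + b * τ.bracket V a t + t * τ.bracket V a b, by ring⟩

/-- The forms df ∧ dg span the exterior square, since exact differentials span Ω. -/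
theorem vanishesAt_of_bracket {X : Scheme.{0}} [X.Over SpecC] (θ : AnticanonicalSection X) (x : X)
    (h : ∀ (U : X.Opens) (_ : x ∈ U) (f g : Γ(X, U)), x ∉ X.basicOpen (θ.bracket f g)) :
    θ.VanishesAt x := by
  intro U hxU α
  let N : Submodule Γ(X, U) (⋀[Γ(X, U)]^2 Ω[Γ(X, U)⁄ℂ]) :=
    Submodule.comap (θ.toLinearMap U) (RingHom.ker (X.evaluation U x hxU).hom)
  have hN : ∀ f g, dWedge f g ∈ N := fun f g ↦
    (Scheme.evaluation_eq_zero_iff_notMem_basicOpen X x hxU _).2 (h U hxU f g)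
  suffices N = ⊤ from (this ▸ Submodule.mem_top : α ∈ N)
  let β (m : Fin 2 → Ω[Γ(X, U)⁄ℂ]) := exteriorPower.ιMulti Γ(X, U) 2 m
  have h1 : ∀ η, (∀ f, β ![KaehlerDifferential.D ℂ _ f, η] ∈ N) → ∀ ω, β ![ω, η] ∈ N := by
    intro η hη ω
    have hω : ω ∈ Submodule.span Γ(X, U) (Set.range (KaehlerDifferential.D ℂ Γ(X, U))) := by
      rw [KaehlerDifferential.span_range_derivation]; trivial
    induction hω using Submodule.span_induction with
    | mem ω hω => obtain ⟨f, rfl⟩ := hω; exact hη f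
    | zero =>
      have : β ![0, η] = 0 := (exteriorPower.ιMulti Γ(X, U) 2).map_coord_zero 0 rfl
      rw [this]; exact zero_mem _
    | add a b _ _ ha hb =>
      have : β ![a + b, η] = β ![a, η] + β ![b, η] :=
        (exteriorPower.ιMulti Γ(X, U) 2).map_vecCons_add ![η] a b
      rw [this]; exact add_mem ha hb
    | smul c a _ ha =>
      have : β ![c • a, η] = c • β ![a, η] :=
        (exteriorPower.ιMulti Γ(X, U) 2).map_vecCons_smul ![η] c a
      rw [this]; exact N.smul_mem c ha
  have swap : ∀ ω η, β ![ω, η] = -β ![η, ω] := fun ω η ↦ by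
    simp only [β]
    rw [← AlternatingMap.map_swap _ _ (i := 0) (j := 1) (by decide)]
    congr 1
    ext i
    fin_cases i <;> rfl
  have h2 : ∀ ω η, β ![ω, η] ∈ N := fun ω η ↦ h1 η (fun f ↦ by
    rw [swap]
    exact neg_mem (h1 _ (fun g ↦ hN g f) η)) ω
  rw [eq_top_iff, ← exteriorPower.ιMulti_span, Submodule.span_le]
  rintro _ ⟨m, rfl⟩
  have := h2 (m 0) (m 1)
  rwa [show ![m 0, m 1] = m from by ext i; fin_cases i <;> rfl] at this

theorem basicOpen_restrict {X : Scheme.{0}} {U V : X.Opens} (h : V ≤ U) (f : Γ(X, U)) :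
    X.basicOpen (restrict h f) = V ⊓ X.basicOpen f := X.basicOpen_res f (homOfLE h).op

theorem vanishesAt_of_isLift {Z : Scheme.{0}} [Z.Over SpecC] {π : Z ⟶ S}
    (hπ : IsBlowupAt x hx π) (θ : AnticanonicalSection S) (τ : PoissonStructure Z)
    (hτ : IsLift π θ τ) : θ.VanishesAt x := by
  obtain ⟨z, hz⟩ := hπ.exists_apply_eq hx
  let I := IdealSheafData.vanishingIdeal ⟨{x}, hx⟩
  have key : ∀ (U : S.affineOpens), x ∈ U.1 → ∀ f ∈ I.ideal U, ∀ g ∈ I.ideal U,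
      x ∉ S.basicOpen (θ.bracket f g) := by
    intro U hxU f hf g hg hxD
    obtain ⟨V, hzV, hVU, t, -, ht⟩ := hπ.isInvertibleIdeal.exists_affine_le (x := z)
      (V := π ⁻¹ᵁ U.1) (by change π z ∈ U.1; rwa [hz])
    have hmem : ∀ f ∈ I.ideal U, restrict hVU (π.app U.1 f) ∈ Ideal.span {t} := by
      intro f hf
      rw [← ht, comap_ideal_of_isAffineOpen π I U V hVU]
      exact Ideal.mem_map_of_mem (π.appLE U V hVU).hom hf
    have h1 : restrict hVU (π.app U.1 (θ.bracket f g)) ∈ Ideal.span {t} := by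
      rw [hτ, τ.restrict_bracket]
      exact bracket_mul_mem_span τ (hmem f hf) (hmem g hg)
    -- The point z lies on E, where every multiple of t vanishes.
    have h2 : z ∈ (I.comap π).support := by
      rw [IdealSheafData.support_comap]
      exact (support_vanishingIdeal_singleton hx _).2 hz
    rw [IdealSheafData.mem_support_iff_of_mem hzV, Scheme.mem_zeroLocus_iff] at h2
    refine h2 _ (show _ ∈ (I.comap π).ideal V from ht ▸ h1) ?_
    rw [basicOpen_restrict, ← Scheme.preimage_basicOpen]
    exact ⟨hzV, by change π z ∈ S.basicOpen _; rwa [hz]⟩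
  refine vanishesAt_of_bracket θ x fun U hxU f g hxD ↦ ?_
  obtain ⟨W, hxW, hWU⟩ := exists_affineOpens_mem_le hxU
  obtain ⟨ε, hε⟩ := exists_algHom_ker_eq_vanishingIdeal hx W hxW
  have hker : ∀ f, f - algebraMap ℂ _ (ε f) ∈ I.ideal W := fun f ↦ by
    rw [← hε]; simp [RingHom.mem_ker]
  -- Constants have zero bracket, so f and g may be replaced by functions vanishing at x.
  have hconst : ∀ (f g : Γ(S, W.1)) c, θ.bracket (f - algebraMap ℂ _ c) g = θ.bracket f g := by
    intro f g c
    have h1 : θ.bracket (algebraMap ℂ _ c) g = 0 := by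
      rw [Algebra.algebraMap_eq_smul_one, θ.bracket_smul_left]
      have := θ.bracket_mul_left 1 1 g
      rw [one_mul, one_mul] at this
      rw [left_eq_add.1 this, smul_zero]
    have h2 := θ.bracket_add_left (f - algebraMap ℂ _ c) (algebraMap ℂ _ c) g
    rw [h1, sub_add_cancel, add_zero] at h2
    exact h2.symm
  have h1 := key W hxW _ (hker (restrict hWU f)) _ (hker (restrict hWU g))
  rw [hconst, θ.bracket_skew, hconst, ← θ.bracket_skew, ← θ.restrict_bracket,
    basicOpen_restrict] at h1
  exact h1 ⟨hxW, hxD⟩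

end

/-! ### Charts of the blowup, from the universal property -/

section

open Scheme

/-- The affine blowup algebra `A[b / a]`, with its universal property. -/
theorem exists_affineBlowupAlgebra {A G : Type} [CommRing A] [CommRing G] (a b : A) (ψ₀ : A →+* G)
    (ha : ψ₀ a ∈ nonZeroDivisors G) {w : G} (hw : ψ₀ b = ψ₀ a * w) :
    ∃ (B : Type) (_ : CommRing B) (β : A →+* B) (ψ : B →+* G), ψ.comp β = ψ₀ ∧
      β a ∈ nonZeroDivisors B ∧ β b ∈ Ideal.span {β a} ∧
      ∀ y, ∃ p : Polynomial A, ψ y = p.eval₂ ψ₀ w := by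
  let L := Localization.Away a
  have hau : IsUnit (algebraMap A L a) := IsLocalization.Away.algebraMap_isUnit a
  obtain ⟨c, hc⟩ : ∃ c : L, algebraMap A L b = algebraMap A L a * c := by
    obtain ⟨a', ha'⟩ := hau.exists_right_inv
    exact ⟨a' * algebraMap A L b, by rw [← mul_assoc, ha', one_mul]⟩
  -- The algebra B will be the image of this map, the subring A[b/a] of the localization at a,
  -- presented as a quotient of A[X].
  let φ : Polynomial A →+* L := Polynomial.eval₂RingHom (algebraMap A L) c
  let M := Localization.Away (ψ₀ a)
  have hinj : Function.Injective (algebraMap G M) :=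
    IsLocalization.injective M (Submonoid.powers_le.2 ha)
  let f : L →+* M := IsLocalization.Away.lift (S := L) a (g := (algebraMap G M).comp ψ₀)
    (IsLocalization.Away.algebraMap_isUnit (S := M) (ψ₀ a))
  have hf : ∀ y, f (algebraMap A L y) = algebraMap G M (ψ₀ y) :=
    fun y ↦ IsLocalization.Away.lift_eq a _ y
  have hcomp : f.comp φ = (algebraMap G M).comp (Polynomial.eval₂RingHom ψ₀ w) := by
    refine Polynomial.ringHom_ext (fun y ↦ by simp [φ, hf]) ?_
    have h1 : algebraMap G M (ψ₀ a) * f c = algebraMap G M (ψ₀ a) * algebraMap G M w := by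
      rw [← map_mul, ← hw, ← hf, ← hf, ← map_mul, hc]
    simpa [φ] using (IsLocalization.Away.algebraMap_isUnit (S := M) (ψ₀ a)).mul_left_cancel h1
  -- A relation satisfied by b/a holds for w after inverting ψ₀ a, hence already in G, where ψ₀ a is
  -- a nonzerodivisor.
  have hker : ∀ p ∈ RingHom.ker φ, Polynomial.eval₂RingHom ψ₀ w p = 0 := by
    intro p hp
    apply hinj
    rw [map_zero, ← RingHom.comp_apply, ← hcomp, RingHom.comp_apply, hp, map_zero]
  refine ⟨Polynomial A ⧸ RingHom.ker φ, inferInstance,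
    (Ideal.Quotient.mk _).comp Polynomial.C, Ideal.Quotient.lift _ _ hker, ?_, ?_, ?_, ?_⟩
  · ext y
    simp
  · rw [mem_nonZeroDivisors_iff_right]
    intro y hy
    obtain ⟨p, rfl⟩ := Ideal.Quotient.mk_surjective y
    rw [RingHom.comp_apply, ← map_mul, Ideal.Quotient.eq_zero_iff_mem, RingHom.mem_ker, map_mul]
      at hy
    have : φ (Polynomial.C a) = algebraMap A L a := by simp [φ]
    rw [this] at hy
    exact Ideal.Quotient.eq_zero_iff_mem.2 (hau.mul_left_eq_zero.1 hy)
  · rw [Ideal.mem_span_singleton]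
    refine ⟨Ideal.Quotient.mk _ Polynomial.X, ?_⟩
    rw [RingHom.comp_apply, RingHom.comp_apply, ← map_mul, Ideal.Quotient.mk_eq_mk_iff_sub_mem,
      RingHom.mem_ker]
    simp [φ, hc]
  · intro y
    obtain ⟨p, rfl⟩ := Ideal.Quotient.mk_surjective y
    exact ⟨p, rfl⟩

/-- Write the pulled back generators as t a₀ and t a₁. They generate (t), so cancelling t gives c₀a₀
+ c₁a₁ = 1, and some aᵢ is invertible near z. -/
theorem exists_affine_ideal_eq_span_appLE {S Z : Scheme.{0}} {π : Z ⟶ S} {I : S.IdealSheafData}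
    (hI : IsInvertibleIdeal (I.comap π)) (U : S.affineOpens) {u : Fin 2 → Γ(S, U.1)}
    (hu : I.ideal U = Ideal.span (Set.range u)) {z : Z} (hz : π z ∈ U.1) {V₀ : Z.Opens}
    (hzV₀ : z ∈ V₀) :
    ∃ (i : Fin 2) (V : Z.affineOpens) (e : V.1 ≤ π ⁻¹ᵁ U.1), z ∈ V.1 ∧ V.1 ≤ V₀ ∧
      π.appLE U.1 V.1 e (u i) ∈ nonZeroDivisors Γ(Z, V.1) ∧
      (I.comap π).ideal V = Ideal.span {π.appLE U.1 V.1 e (u i)} := by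
  obtain ⟨V, hzV, hVU, t, ht, htI⟩ := hI.exists_affine_le (x := z) (V := π ⁻¹ᵁ U.1 ⊓ V₀) ⟨hz, hzV₀⟩
  have e : V.1 ≤ π ⁻¹ᵁ U.1 := hVU.trans inf_le_left
  have h1 : Ideal.span {t} = Ideal.span (Set.range fun i ↦ π.appLE U.1 V.1 e (u i)) := by
    rw [← htI, comap_ideal_of_isAffineOpen π I U V e, hu, Ideal.map_span, ← Set.range_comp]
    rfl
  have h2 : ∀ i, ∃ a, π.appLE U.1 V.1 e (u i) = t * a := fun i ↦
    Ideal.mem_span_singleton.1 (h1 ▸ Ideal.subset_span ⟨i, rfl⟩)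
  choose a ha using h2
  have h3 : t ∈ Ideal.span (Set.range fun i ↦ π.appLE U.1 V.1 e (u i)) :=
    h1 ▸ Ideal.mem_span_singleton_self t
  obtain ⟨c, hc⟩ := (Ideal.mem_span_range_iff_exists_fun).1 h3
  have h4 : c 0 * a 0 + c 1 * a 1 = 1 := by
    rw [Fin.sum_univ_two, ha, ha] at hc
    have h5 : t * (c 0 * a 0 + c 1 * a 1 - 1) = 0 := by linear_combination hc
    exact sub_eq_zero.1 ((mem_nonZeroDivisors_iff.1 ht).1 _ h5)
  obtain ⟨i, hi⟩ : ∃ i, z ∈ Z.basicOpen (a i) := by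
    by_contra! hne
    have h6 : z ∈ Z.basicOpen (1 : Γ(Z, V.1)) := by rwa [Scheme.basicOpen_one]
    rw [← h4] at h6
    have h7 := Z.basicOpen_add_le (c 0 * a 0) (c 1 * a 1) h6
    rw [Scheme.basicOpen_mul, Scheme.basicOpen_mul] at h7
    exact h7.elim (fun h ↦ hne 0 h.2) (fun h ↦ hne 1 h.2)
  have e' : Z.basicOpen (a i) ≤ π ⁻¹ᵁ U.1 := (Z.basicOpen_le _).trans e
  have hai : IsUnit (restrict (Z.basicOpen_le (a i)) (a i)) :=
    RingedSpace.isUnit_res_basicOpen Z.toRingedSpace (a i)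
  have h5 : π.appLE U.1 (Z.basicOpen (a i)) e' (u i) =
      restrict (Z.basicOpen_le (a i)) t * restrict (Z.basicOpen_le (a i)) (a i) := by
    rw [← map_mul, ← ha, ← Scheme.Hom.appLE_map π e (homOfLE (Z.basicOpen_le (a i))).op]
    rfl
  refine ⟨i, Z.affineBasicOpen (a i), e', hi,
    (Z.basicOpen_le _).trans (hVU.trans inf_le_right), ?_, ?_⟩
  · rw [show π.appLE U.1 (Z.affineBasicOpen (a i)).1 e' (u i) = _ from h5]
    exact mul_mem (nonZeroDivisors_map_basicOpen V.2 _ t ht) hai.mem_nonZeroDivisors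
  · refine (IdealSheafData.map_ideal_basicOpen _ V (a i)).symm.trans ?_
    rw [htI, Ideal.map_span, Set.image_singleton]
    refine Eq.trans ?_ (congrArg (fun y ↦ Ideal.span {y}) h5.symm)
    exact (Ideal.span_singleton_mul_right_unit hai _).symm

/-- On the chart of the blowup of `(a, b)` where `a` generates the exceptional divisor, functions
are locally fractions of polynomials in `w = b / a` with coefficients on the base. -/
theorem IsBlowup.exists_fraction {S Z : Scheme.{0}} {π : Z ⟶ S} {I : S.IdealSheafData}
    (hπ : IsBlowup I π) (U : S.affineOpens) {a b : Γ(S, U.1)} (hI : I.ideal U = Ideal.span {a, b})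
    (V : Z.affineOpens) (e : V.1 ≤ π ⁻¹ᵁ U.1)
    (ha : π.appLE U.1 V.1 e a ∈ nonZeroDivisors Γ(Z, V.1))
    (hV : (I.comap π).ideal V = Ideal.span {π.appLE U.1 V.1 e a}) {w : Γ(Z, V.1)}
    (hw : π.appLE U.1 V.1 e b = π.appLE U.1 V.1 e a * w) {V₀ : Z.Opens} (f : Γ(Z, V₀)) {z : Z}
    (hz : z ∈ V₀) (hzV : z ∈ V.1) :
    ∃ (p q : Polynomial Γ(S, U.1)) (V₁ : Z.Opens) (h₀ : V₁ ≤ V₀) (h : V₁ ≤ V.1), z ∈ V₁ ∧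
      IsUnit (restrict h (q.eval₂ (π.appLE U.1 V.1 e).hom w)) ∧
      restrict h₀ f * restrict h (q.eval₂ (π.appLE U.1 V.1 e).hom w) =
        restrict h (p.eval₂ (π.appLE U.1 V.1 e).hom w) := by
  obtain ⟨B, _, β, ψ, hψβ, hβa, hβb, hψ⟩ :=
    exists_affineBlowupAlgebra a b (π.appLE U.1 V.1 e).hom ha hw
  obtain ⟨h, hh, -⟩ := hπ.existsUnique_lift _ _
    (isInvertibleIdeal_comap_Spec (I := I) U (R := CommRingCat.of B) (CommRingCat.ofHom β)
      hβa (by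
        rw [hI, Ideal.map_span, Set.image_pair, Ideal.span_insert]
        exact sup_eq_left.2 (Ideal.span_le.2 (Set.singleton_subset_iff.2 hβb))))
  let ψ' : CommRingCat.of B ⟶ Γ(Z, V.1) := CommRingCat.ofHom ψ
  -- Both morphisms lift the same map to S, so the inclusion of the chart V factors through Spec
  -- A[b/a].
  have hk : Spec.map ψ' ≫ h = V.2.fromSpec := by
    obtain ⟨_, -, huniq⟩ := hπ.existsUnique_lift _ _
      (isInvertibleIdeal_comap_Spec (I := I) U (π.appLE U.1 V.1 e) ha (by
        rw [← hV, comap_ideal_of_isAffineOpen π I U V e]))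
    refine (huniq _ ?_).trans (huniq _ ?_).symm
    · change (Spec.map ψ' ≫ h) ≫ π = _
      rw [Category.assoc, hh, ← Category.assoc, ← Spec.map_comp]
      congr 2
      exact CommRingCat.hom_ext hψβ
    · exact (IsAffineOpen.SpecMap_appLE_fromSpec π U.2 V.2 e).symm
  have := IsAffineOpen.isOpenImmersion_fromSpec V.2
  obtain ⟨y, hy⟩ : z ∈ Set.range V.2.fromSpec := by rwa [V.2.range_fromSpec]
  have hhy : h (Spec.map ψ' y) = z := by
    rw [← hy, ← hk]
    exact (Scheme.Hom.comp_apply _ _ _).symm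
  -- Pulled back to Spec B, near the image of z, f is a fraction c/dⁿ. Carried to V, its numerator
  -- and denominator become polynomials in w.
  obtain ⟨d, hdV₀, hyd⟩ := (isAffineOpen_top (Spec (CommRingCat.of B))).exists_basicOpen_le
    (V := h ⁻¹ᵁ V₀) ⟨Spec.map ψ' y, by change h (Spec.map ψ' y) ∈ V₀; rwa [hhy]⟩ trivial
  have := (isAffineOpen_top (Spec (CommRingCat.of B))).isLocalization_basicOpen d
  obtain ⟨n, c, hc⟩ := IsLocalization.Away.surj d (h.appLE V₀ _ hdV₀ f)
  let D' := Spec.map ψ' ⁻¹ᵁ (Spec (CommRingCat.of B)).basicOpen d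
  let V₁ := V.2.fromSpec ''ᵁ D'
  have h₀ : V₁ ≤ V₀ := by
    rintro _ ⟨t, ht, rfl⟩
    have : V.2.fromSpec t = h (Spec.map ψ' t) := by
      rw [← hk]
      exact Scheme.Hom.comp_apply _ _ _
    exact this ▸ hdV₀ ht
  have h₁ : V₁ ≤ V.1 := by
    rintro _ ⟨t, -, rfl⟩
    have : V.2.fromSpec t ∈ Set.range V.2.fromSpec := ⟨t, rfl⟩
    rwa [V.2.range_fromSpec] at this
  let κ := (V.2.fromSpec.appIso D').commRingCatIsoToRingEquiv
  let γ := ((Spec.map ψ').appLE ((Spec (CommRingCat.of B)).basicOpen d) D' le_rfl).hom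
  have hκ : ∀ s, κ s = V.2.fromSpec.appLE V₁ D' (V.2.fromSpec.preimage_image_eq D').ge s := by
    intro s
    change (V.2.fromSpec.appIso D').hom s = _
    rw [Scheme.Hom.appIso_hom']
  have hκ' : ∀ {O : Z.Opens} (hO : V₁ ≤ O) (s : Γ(Z, O)), κ (restrict hO s) =
      V.2.fromSpec.appLE O D' ((V.2.fromSpec.preimage_image_eq D').ge.trans
        (V.2.fromSpec.preimage_mono hO)) s := by
    intro O hO s
    rw [hκ, ← Scheme.Hom.map_appLE V.2.fromSpec (V.2.fromSpec.preimage_image_eq D').ge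
      (homOfLE hO).op]
    rfl
  have hκf : κ (restrict h₀ f) = γ (h.appLE V₀ _ hdV₀ f) := by
    rw [hκ']
    have h2 := Scheme.Hom.appLE_comp_appLE (Spec.map ψ') h V₀ _ D' hdV₀ le_rfl
    simp only [hk] at h2
    rw [← h2]
    rfl
  have hκψ : ∀ s : B, κ (restrict h₁ (ψ s)) =
      γ (algebraMap _ _ ((Scheme.ΓSpecIso (CommRingCat.of B)).inv s)) := by
    intro s
    have h2 := (Scheme.Hom.appLE_map V.2.fromSpec (U := V.1) V.2.fromSpec_preimage_self.ge
      (homOfLE (le_top : D' ≤ ⊤)).op).symm.trans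
        (congrArg (· ≫ _) (fromSpec_appLE_top V.2 V.2.fromSpec_preimage_self.ge))
    rw [hκ', h2]
    change ((ψ' ≫ (Scheme.ΓSpecIso _).inv) ≫ (Spec Γ(Z, V.1)).presheaf.map _) s = _
    have h3 : (Spec.map ψ').appTop ≫ (Spec Γ(Z, V.1)).presheaf.map
        (homOfLE (le_top : D' ≤ ⊤)).op = (Spec (CommRingCat.of B)).presheaf.map
          (homOfLE ((Spec (CommRingCat.of B)).basicOpen_le d)).op ≫
            (Spec.map ψ').appLE _ D' le_rfl := by
      rw [Scheme.Hom.map_appLE, Scheme.Hom.appLE]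
      rfl
    rw [Scheme.ΓSpecIso_inv_naturality, Category.assoc, h3]
    rfl
  let ι := (Scheme.ΓSpecIso (CommRingCat.of B)).commRingCatIsoToRingEquiv
  have hι : ∀ t, (Scheme.ΓSpecIso (CommRingCat.of B)).inv (ι t) = t := ι.symm_apply_apply
  obtain ⟨p, hp⟩ := hψ (ι c)
  obtain ⟨q, hq⟩ := hψ (ι (d ^ n))
  refine ⟨p, q, V₁, h₀, h₁, ⟨y, hyd, hy⟩, ?_, ?_⟩
  · rw [← hq, ← isUnit_map_iff κ, hκψ, hι, map_pow, map_pow]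
    exact ((IsLocalization.Away.algebraMap_isUnit d).map γ).pow n
  · apply κ.injective
    rw [map_mul, ← hp, ← hq, hκf, hκψ, hκψ, hι, hι, ← map_mul, map_pow, hc]

end

/-! ### Brackets of fractions, and pullback to an open subscheme of S -/

section

open Scheme

/-- Here R stands for functions on a chart of Z and T for functions off E. Pairs whose bracket comes
from R are stable under sums, products and division by units, so only the pairs (c, c'), (c, w) and
(w, w) matter. -/
theorem exists_eq_bracket_of_fraction {A R T : Type} [CommRing A] [CommRing R] [CommRing T]
    [Algebra ℂ T] (α : A →+* R) (σ : R →+* T) (B : T →ₗ[ℂ] T →ₗ[ℂ] T)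
    (skew : ∀ f g, B f g = -B g f) (leibniz : ∀ f g h, B f (g * h) = g * B f h + h * B f g)
    {a b : A} {w : R} (hw : α b = α a * w) (hunit : IsUnit (σ (α a)))
    (hB : ∀ c c', ∃ k, B (σ (α c)) (σ (α c')) = σ (α a * k))
    {f g p q p' q' : R} (hf : f * q = p) (hq : IsUnit q) (hg : g * q' = p') (hq' : IsUnit q')
    (hp₀ : ∃ P : Polynomial A, p = P.eval₂ α w) (hq₀ : ∃ P : Polynomial A, q = P.eval₂ α w)
    (hp₀' : ∃ P : Polynomial A, p' = P.eval₂ α w) (hq₀' : ∃ P : Polynomial A, q' = P.eval₂ α w) :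
    ∃ h, σ h = B (σ f) (σ g) := by
  let Good (f g : R) : Prop := ∃ h, σ h = B (σ f) (σ g)
  have leibniz' : ∀ f g h, B (f * g) h = f * B g h + g * B f h := fun f g h ↦ by
    rw [skew, leibniz, skew h g, skew h f]; ring
  have symm : ∀ {f g}, Good f g → Good g f := by
    rintro f g ⟨h, hh⟩
    exact ⟨-h, by rw [map_neg, hh, ← skew]⟩
  have add : ∀ {f f' g}, Good f g → Good f' g → Good (f + f') g := by
    rintro f f' g ⟨h, hh⟩ ⟨h', hh'⟩
    exact ⟨h + h', by rw [map_add, map_add, map_add, LinearMap.add_apply, hh, hh']⟩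
  have mul : ∀ {f f' g}, Good f g → Good f' g → Good (f * f') g := by
    rintro f f' g ⟨h, hh⟩ ⟨h', hh'⟩
    exact ⟨f * h' + f' * h, by simp only [map_add, map_mul, leibniz', hh, hh']⟩
  have frac : ∀ {f p q g}, f * q = p → IsUnit q → Good p g → Good q g → Good f g := by
    rintro f _ q g rfl hq ⟨h, hh⟩ ⟨h', hh'⟩
    obtain ⟨r, hr⟩ := hq.exists_right_inv
    refine ⟨r * (h - f * h'), ?_⟩
    have hr' : σ q * σ r = 1 := by rw [← map_mul, hr, map_one]
    rw [map_mul, leibniz'] at hh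
    simp only [map_mul, map_sub, hh, hh']
    linear_combination B (σ f) (σ g) * hr'
  have eval : ∀ {g}, (∀ c, Good (α c) g) → Good w g → ∀ p, (∃ P : Polynomial A, p = P.eval₂ α w) →
      Good p g := by
    rintro g hc hw _ ⟨P, rfl⟩
    induction P using Polynomial.induction_on with
    | C c => rw [Polynomial.eval₂_C]; exact hc c
    | add P Q hP hQ => rw [Polynomial.eval₂_add]; exact add hP hQ
    | monomial n c h =>
      rw [pow_succ, ← mul_assoc, Polynomial.eval₂_mul, Polynomial.eval₂_X]
      exact mul h hw
  have good_coeff : ∀ c c', Good (α c) (α c') := fun c c' ↦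
    (hB c c').elim fun k hk ↦ ⟨_, hk.symm⟩
  -- From {c, b} = a{c, w} + w{c, a}, with both brackets on S divisible by a.
  have good_coeff_w : ∀ c, Good (α c) w := by
    intro c
    obtain ⟨k, hk⟩ := hB c b
    obtain ⟨k', hk'⟩ := hB c a
    refine ⟨k - w * k', hunit.mul_left_cancel ?_⟩
    rw [hw, map_mul, leibniz, hk'] at hk
    simp only [map_mul, map_sub] at hk ⊢
    linear_combination -hk
  have good_w_w : Good w w := ⟨0, by rw [map_zero, eq_zero_of_eq_neg (skew (σ w) (σ w))]⟩
  have frac_coeff : ∀ {f p q}, f * q = p → IsUnit q → (∃ P : Polynomial A, p = P.eval₂ α w) →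
      (∃ P : Polynomial A, q = P.eval₂ α w) → ∀ c, Good f (α c) := fun h hq hp₀ hq₀ c ↦
    frac h hq (eval (fun c' ↦ good_coeff c' c) (symm (good_coeff_w c)) _ hp₀)
      (eval (fun c' ↦ good_coeff c' c) (symm (good_coeff_w c)) _ hq₀)
  have frac_w : ∀ {f p q}, f * q = p → IsUnit q → (∃ P : Polynomial A, p = P.eval₂ α w) →
      (∃ P : Polynomial A, q = P.eval₂ α w) → Good f w := fun h hq hp₀ hq₀ ↦
    frac h hq (eval good_coeff_w good_w_w _ hp₀) (eval good_coeff_w good_w_w _ hq₀)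
  have h1 := fun c ↦ symm (frac_coeff hg hq' hp₀' hq₀' c)
  have h2 := symm (frac_w hg hq' hp₀' hq₀')
  exact frac hf hq (eval h1 h2 _ hp₀) (eval h1 h2 _ hq₀)

section Push

variable {S Z : Scheme.{0}} {Y : S.Opens} (s : Y.toScheme ⟶ Z)

/-- The preimage of an open subset of `Z` under `s : Y ⟶ Z`, as an open subset of `S`. -/
def preimageOpens (V : Z.Opens) : S.Opens := Y.ι ''ᵁ (s ⁻¹ᵁ V)

/-- Pullback of functions along `s : Y ⟶ Z`, with `Y` an open subscheme of `S`. -/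
def pull (V : Z.Opens) : Γ(Z, V) →+* Γ(S, preimageOpens s V) := (s.app V).hom

theorem preimageOpens_mono {V W : Z.Opens} (h : V ≤ W) : preimageOpens s V ≤ preimageOpens s W :=
  Y.ι.image_mono (s.preimage_mono h)

theorem mem_preimageOpens {V : Z.Opens} {y : S} :
    y ∈ preimageOpens s V ↔ ∃ y' : Y, s y' ∈ V ∧ y'.1 = y := Iff.rfl

theorem pull_restrict {V W : Z.Opens} (h : V ≤ W) (f : Γ(Z, W)) :
    pull s V (restrict h f) = restrict (preimageOpens_mono s h) (pull s W f) :=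
  congr($(s.naturality (homOfLE h).op) f)

theorem preimageOpens_le {π : Z ⟶ S} (hs : s ≫ π = Y.ι) {U : S.Opens} {V : Z.Opens}
    (e : V ≤ π ⁻¹ᵁ U) : preimageOpens s V ≤ U := by
  rintro _ ⟨y, hy, rfl⟩
  have h : Y.ι y = π (s y) := by
    rw [← hs]
    exact Scheme.Hom.comp_apply s π y
  exact (h ▸ e hy : Y.ι y ∈ U)

theorem pull_appLE {π : Z ⟶ S} (hs : s ≫ π = Y.ι) {U : S.Opens} {V : Z.Opens}
    (e : V ≤ π ⁻¹ᵁ U) (f : Γ(S, U)) :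
    pull s V (π.appLE U V e f) = restrict (preimageOpens_le s hs e) f := by
  have h := Scheme.Hom.appLE_comp_appLE s π U V (s ⁻¹ᵁ V) e le_rfl
  simp only [hs, Scheme.Opens.ι_appLE] at h
  rw [Scheme.Hom.appLE_eq_app] at h
  exact congr($h f)

end Push

theorem exists_glue {X : Scheme.{0}} {U : X.Opens} (V : U → X.Opens) (hV : ∀ x, V x ≤ U)
    (hx : ∀ x, x.1 ∈ V x) (f : ∀ x, Γ(X, V x))
    (h : ∀ x y, restrict (inf_le_left : V x ⊓ V y ≤ V x) (f x) =
      restrict (inf_le_right : V x ⊓ V y ≤ V y) (f y)) :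
    ∃ g : Γ(X, U), ∀ x, restrict (hV x) g = f x := by
  obtain ⟨g, hg, -⟩ := X.sheaf.existsUnique_gluing' V U (fun x ↦ homOfLE (hV x))
    (fun x hxU ↦ Opens.mem_iSup.2 ⟨⟨x, hxU⟩, hx _⟩) f h
  exact ⟨g, hg⟩

end

/-! ### Extending the bracket over the exceptional divisor -/

section

open Scheme

/-- The complement of a closed point. -/
def puncture {S : Scheme.{0}} {x : S} (hx : IsClosed {x}) : S.Opens := ⟨{x}ᶜ, hx.isOpen_compl⟩

section Blowup

variable {S Z : Scheme.{0}} {x : S} {hx : IsClosed {x}} {π : Z ⟶ S}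

theorem IsBlowupAt.exists_section (hπ : IsBlowupAt x hx π) :
    ∃ s : (puncture hx).toScheme ⟶ Z, s ≫ π = (puncture hx).ι := by
  obtain ⟨s, hs, -⟩ := hπ.existsUnique_lift _ (puncture hx).ι
    (isInvertibleIdeal_comap_of_disjoint _ fun y hy ↦
      y.2 ((support_vanishingIdeal_singleton hx _).1 hy))
  exact ⟨s, hs⟩

variable {s : (puncture hx).toScheme ⟶ Z}

/-- Off E the section s inverts π: by uniqueness of lifts, the inclusion of W into Z factors through
s. -/
theorem IsBlowupAt.restrict_eq_zero (hπ : IsBlowupAt x hx π) (hs : s ≫ π = (puncture hx).ι)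
    {V W : Z.Opens} (h : W ≤ V) (hW : ∀ z ∈ W, π z ≠ x) {f : Γ(Z, V)} (hf : pull s V f = 0) :
    restrict h f = 0 := by
  let l : W.toScheme ⟶ (puncture hx).toScheme :=
    IsOpenImmersion.lift (puncture hx).ι (W.ι ≫ π) (by
      rw [Scheme.Opens.range_ι]
      rintro _ ⟨z, rfl⟩
      have : (W.ι ≫ π) z = π z.1 := Scheme.Hom.comp_apply _ _ _
      rw [this]
      exact hW z.1 z.2)
  have hl : l ≫ (puncture hx).ι = W.ι ≫ π := IsOpenImmersion.lift_fac _ _ _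
  obtain ⟨_, -, huniq⟩ := hπ.existsUnique_lift _ (W.ι ≫ π)
    (isInvertibleIdeal_comap_of_disjoint _ fun z hz ↦ by
      rw [support_vanishingIdeal_singleton hx] at hz
      exact hW z.1 z.2 ((Scheme.Hom.comp_apply _ _ _).symm.trans hz))
  have hls : l ≫ s = W.ι := (huniq _ (by
    change (l ≫ s) ≫ π = _
    rw [Category.assoc, hs, hl])).trans (huniq _ rfl).symm
  have e : (⊤ : W.toScheme.Opens) ≤ W.ι ⁻¹ᵁ V := fun z _ ↦ h z.2
  have e' : ⊤ ≤ l ⁻¹ᵁ s ⁻¹ᵁ V := by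
    rw [← Scheme.Hom.comp_preimage, hls]
    exact e
  have h1 := Scheme.Hom.appLE_comp_appLE l s V (s ⁻¹ᵁ V) ⊤ le_rfl e'
  simp only [hls, Scheme.Opens.ι_appLE] at h1
  rw [Scheme.Hom.appLE_eq_app] at h1
  have h2 := congr($h1 f)
  have h3 : s.app V f = 0 := hf
  have h4 : restrict (show W.ι ''ᵁ ⊤ ≤ V by simpa using h) f = 0 := by
    refine Eq.trans h2.symm ?_
    change (l.appLE _ _ _) (s.app V f) = 0
    rw [h3, map_zero]
  have h5 := congrArg (restrict (show W ≤ W.ι ''ᵁ ⊤ by simp)) h4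
  rwa [restrict_restrict, map_zero] at h5

/-- A function killed by s vanishes off E, so a power of the local equation of E kills it; that
equation is a nonzerodivisor. -/
theorem IsBlowupAt.pull_injective (hπ : IsBlowupAt x hx π) (hs : s ≫ π = (puncture hx).ι)
    (V : Z.Opens) : Function.Injective (pull s V) := by
  rw [injective_iff_map_eq_zero]
  intro f hf
  refine eq_of_locally_eq' _ _ fun z hz ↦ ?_
  obtain ⟨W, hzW, hWV, a, ha, haI⟩ := hπ.isInvertibleIdeal.exists_affine_le hz
  refine ⟨W.1, hWV, hzW, ?_⟩
  have hD : ∀ z ∈ Z.basicOpen a, π z ≠ x := by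
    intro z hz hzx
    have h2 : z ∈ (IdealSheafData.comap
        (IdealSheafData.vanishingIdeal ⟨{x}, hx⟩) π).support := by
      rw [IdealSheafData.support_comap]
      exact (support_vanishingIdeal_singleton hx _).2 hzx
    rw [IdealSheafData.mem_support_iff_of_mem (Z.basicOpen_le a hz), Scheme.mem_zeroLocus_iff] at h2
    exact h2 a (haI ▸ Ideal.mem_span_singleton_self a) hz
  have h1 := hπ.restrict_eq_zero hs ((Z.basicOpen_le a).trans hWV) hD hf
  have := W.2.isLocalization_basicOpen a
  rw [← restrict_restrict hWV (Z.basicOpen_le a)] at h1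
  have h2 : algebraMap Γ(Z, W.1) Γ(Z, Z.basicOpen a) (restrict hWV f) = 0 := h1
  rw [IsLocalization.map_eq_zero_iff (Submonoid.powers a)] at h2
  obtain ⟨⟨_, n, rfl⟩, hn⟩ := h2
  rw [map_zero]
  exact (mem_nonZeroDivisors_iff.1 (pow_mem ha n)).1 _ hn

/-- Away from x the functions a and b have no common zero, and b = aw vanishes wherever a does. -/
theorem isUnit_pull_appLE (hs : s ≫ π = (puncture hx).ι) (U : S.affineOpens) {a b : Γ(S, U.1)}
    (hI : (IdealSheafData.vanishingIdeal ⟨{x}, hx⟩).ideal U = Ideal.span {a, b}) {V : Z.Opens}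
    (e : V ≤ π ⁻¹ᵁ U.1) {w : Γ(Z, V)} (hw : π.appLE U.1 V e b = π.appLE U.1 V e a * w) :
    IsUnit (pull s V (π.appLE U.1 V e a)) := by
  have h1 := congrArg (pull s V) hw
  rw [map_mul, pull_appLE s hs, pull_appLE s hs] at h1
  rw [pull_appLE s hs]
  refine RingedSpace.isUnit_of_isUnit_germ S.toRingedSpace _ _ fun y hy ↦ ?_
  refine (Scheme.mem_basicOpen S _ y hy).1 ?_
  have hyU := preimageOpens_le s hs e hy
  have hyx : y ≠ x := by
    obtain ⟨y', -, rfl⟩ := (mem_preimageOpens s).1 hy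
    exact y'.2
  obtain ⟨f, hf, hyf⟩ := exists_mem_vanishingIdeal_singleton hx U hyU hyx
  rw [hI, Ideal.mem_span_pair] at hf
  obtain ⟨c, d, rfl⟩ := hf
  rw [basicOpen_restrict]
  refine ⟨hy, ?_⟩
  have h2 := S.basicOpen_add_le _ _ hyf
  rw [Scheme.basicOpen_mul, Scheme.basicOpen_mul] at h2
  refine h2.elim (fun h ↦ h.2) fun h ↦ ?_
  have h3 : y ∈ S.basicOpen (restrict (preimageOpens_le s hs e) b) := by
    rw [basicOpen_restrict]
    exact ⟨hy, h.2⟩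
  rw [h1, Scheme.basicOpen_mul, basicOpen_restrict] at h3
  exact h3.1.2

end Blowup

theorem AnticanonicalSection.VanishesAt.bracket_mem {S : Scheme.{0}} [S.Over SpecC]
    {θ : AnticanonicalSection S} {x : S} (hθ : θ.VanishesAt x) (hx : IsClosed {x})
    (U : S.affineOpens) (f g : Γ(S, U.1)) :
    θ.bracket f g ∈ (IdealSheafData.vanishingIdeal ⟨{x}, hx⟩).ideal U := by
  by_cases hxU : x ∈ U.1
  · rw [mem_vanishingIdeal_singleton_iff hx U hxU]
    exact (Scheme.evaluation_eq_zero_iff_notMem_basicOpen S x hxU _).1 (hθ U.1 hxU _)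
  · rw [vanishingIdeal_singleton_ideal_of_notMem hx U hxU]
    trivial

section Extension

variable {S Z : Scheme.{0}} [S.Over SpecC] {x : S} {hx : IsClosed {x}} {π : Z ⟶ S}
  {s : (puncture hx).toScheme ⟶ Z} {θ : AnticanonicalSection S}

theorem pull_restrict_eq_bracket {V W : Z.Opens} (h : W ≤ V) {f g k : Γ(Z, V)}
    (hk : pull s V k = θ.bracket (pull s V f) (pull s V g)) :
    pull s W (restrict h k) = θ.bracket (pull s W (restrict h f)) (pull s W (restrict h g)) := by
  rw [pull_restrict, hk, θ.restrict_bracket, pull_restrict, pull_restrict]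

/-- Local solutions agree on overlaps by injectivity, so they glue. -/
theorem exists_pull_eq_bracket_of_locally (hinj : ∀ V, Function.Injective (pull s V)) {V : Z.Opens}
    (f g : Γ(Z, V)) (h : ∀ z ∈ V, ∃ (W : Z.Opens) (hW : W ≤ V) (_ : z ∈ W) (k : Γ(Z, W)),
      pull s W k = θ.bracket (pull s W (restrict hW f)) (pull s W (restrict hW g))) :
    ∃ k, pull s V k = θ.bracket (pull s V f) (pull s V g) := by
  choose W hW hz k hk using h
  obtain ⟨K, hK⟩ := exists_glue (fun z : V ↦ W z.1 z.2) (fun z ↦ hW _ _) (fun z ↦ hz _ _)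
    (fun z ↦ k _ _) (fun y z ↦ hinj _ (by
      rw [pull_restrict_eq_bracket _ (hk _ _), pull_restrict_eq_bracket _ (hk _ _)]
      simp only [restrict_restrict]))
  refine ⟨K, eq_of_locally_eq' _ _ fun y hy ↦ ?_⟩
  obtain ⟨y', hy', rfl⟩ := (mem_preimageOpens s).1 hy
  refine ⟨preimageOpens s (W _ hy'), preimageOpens_mono s (hW _ hy'),
    (mem_preimageOpens s).2 ⟨y', hz _ _, rfl⟩, ?_⟩
  rw [← pull_restrict s (hW _ hy'), hK ⟨_, hy'⟩, hk, θ.restrict_bracket, pull_restrict,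
    pull_restrict]

theorem exists_pull_eq_bracket [SmoothOfRelativeDimension 2 (S ↘ SpecC)] (hπ : IsBlowupAt x hx π) (hs : s ≫ π = (puncture hx).ι)
    (hθ : θ.VanishesAt x) {V : Z.Opens} (f g : Γ(Z, V)) :
    ∃ k, pull s V k = θ.bracket (pull s V f) (pull s V g) := by
  refine exists_pull_eq_bracket_of_locally (hπ.pull_injective hs) f g fun z hz ↦ ?_
  obtain ⟨U, u, hzU, hu⟩ := exists_vanishingIdeal_eq_span hx (π z)
  obtain ⟨i, W, e, hzW, hWV, ha, haI⟩ :=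
    exists_affine_ideal_eq_span_appLE hπ.isInvertibleIdeal U hu hzU hz
  obtain ⟨b, hI⟩ : ∃ b, (IdealSheafData.vanishingIdeal ⟨{x}, hx⟩).ideal U =
      Ideal.span {u i, b} := by
    -- In `Fin 2`, `1 - i` is the other index.
    refine ⟨u (1 - i), hu.trans ?_⟩
    congr 1
    ext y
    fin_cases i <;> simp [Fin.exists_fin_two, eq_comm, or_comm]
  have hdvd : ∀ t ∈ (IdealSheafData.vanishingIdeal ⟨{x}, hx⟩).ideal U,
      ∃ k, π.appLE U.1 W.1 e t = π.appLE U.1 W.1 e (u i) * k := by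
    intro t ht
    refine Ideal.mem_span_singleton.1 ?_
    rw [← haI, comap_ideal_of_isAffineOpen π _ U W e]
    exact Ideal.mem_map_of_mem (π.appLE U.1 W.1 e).hom ht
  obtain ⟨w, hw⟩ := hdvd b (by rw [hI]; exact Ideal.subset_span (by simp))
  obtain ⟨p, q, W₁, h₁, h₁', hz₁, hq, hf⟩ := hπ.exists_fraction U hI W e ha haI hw f hz hzW
  obtain ⟨p', q', W₂, h₂, h₂', hz₂, hq', hg⟩ := hπ.exists_fraction U hI W e ha haI hw g hz hzW
  let O := W₁ ⊓ W₂
  have hO : O ≤ W.1 := inf_le_left.trans h₁'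
  have e' : O ≤ π ⁻¹ᵁ U.1 := hO.trans e
  have hα : ∀ c, π.appLE U.1 O e' c = restrict hO (π.appLE U.1 W.1 e c) := by
    intro c
    rw [← Scheme.Hom.appLE_map π e (homOfLE hO).op]
    rfl
  have hα' : (restrict hO).comp (π.appLE U.1 W.1 e).hom = (π.appLE U.1 O e').hom :=
    RingHom.ext fun c ↦ (hα c).symm
  have heval : ∀ p : Polynomial Γ(S, U.1), restrict hO (p.eval₂ (π.appLE U.1 W.1 e).hom w) =
      p.eval₂ (π.appLE U.1 O e').hom (restrict hO w) := fun p ↦ by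
    rw [Polynomial.hom_eval₂, hα']
  have hw' : π.appLE U.1 O e' b = π.appLE U.1 O e' (u i) * restrict hO w := by
    rw [hα, hα, hw, map_mul]
  refine ⟨O, inf_le_left.trans h₁, ⟨hz₁, hz₂⟩, ?_⟩
  have hf' := congrArg (restrict (inf_le_left : O ≤ W₁)) hf
  have hg' := congrArg (restrict (inf_le_right : O ≤ W₂)) hg
  have hq₁ := hq.map (restrict (inf_le_left : O ≤ W₁))
  have hq₂ := hq'.map (restrict (inf_le_right : O ≤ W₂))
  simp only [map_mul, restrict_restrict] at hf' hg' hq₁ hq₂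
  refine exists_eq_bracket_of_fraction (π.appLE U.1 O e').hom (pull s O) (θ.bilinear _)
    θ.bracket_skew θ.bracket_mul_right hw' (isUnit_pull_appLE hs U hI e' hw') ?_ hf' hq₁ hg' hq₂
    ⟨p, heval p⟩ ⟨q, heval q⟩ ⟨p', heval p'⟩ ⟨q', heval q'⟩
  intro c c'
  -- Here θ(x) = 0 enters: brackets on S lie in the ideal of x, so upstairs they are divisible by u
  -- i.
  obtain ⟨k, hk⟩ := hdvd _ (hθ.bracket_mem hx U c c')
  refine ⟨restrict hO k, ?_⟩
  change θ.bracket (pull s O (π.appLE U.1 O e' c)) (pull s O (π.appLE U.1 O e' c')) =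
    pull s O (π.appLE U.1 O e' (u i) * _)
  rw [pull_appLE s hs, pull_appLE s hs, ← θ.restrict_bracket, ← pull_appLE s hs e', hα, hk, map_mul,
    hα]

/-- The extension of the bracket of `θ` along `s`. -/
def extendedBracket
    (hex : ∀ (V : Z.Opens) (f g : Γ(Z, V)), ∃ k, pull s V k = θ.bracket (pull s V f) (pull s V g))
    (V : Z.Opens) (f g : Γ(Z, V)) : Γ(Z, V) :=
  (hex V f g).choose

theorem pull_extendedBracket
    (hex : ∀ (V : Z.Opens) (f g : Γ(Z, V)), ∃ k, pull s V k = θ.bracket (pull s V f) (pull s V g))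
    (V : Z.Opens) (f g : Γ(Z, V)) :
    pull s V (extendedBracket hex V f g) = θ.bilinear _ (pull s V f) (pull s V g) :=
  (hex V f g).choose_spec

variable [Z.Over SpecC] [π.IsOver SpecC]

theorem pull_algebraMap (hs : s ≫ π = (puncture hx).ι) (V : Z.Opens) (c : ℂ) :
    pull s V (algebraMap ℂ _ c) = algebraMap ℂ _ c := by
  rw [← appLE_algebraMap π ⊤ V (π.preimage_top ▸ le_top), pull_appLE s hs, restrict_algebraMap]

theorem pull_smul (hs : s ≫ π = (puncture hx).ι) {V : Z.Opens} (c : ℂ) (f : Γ(Z, V)) :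
    pull s V (c • f) = c • pull s V f := by
  rw [Algebra.smul_def, Algebra.smul_def, map_mul, pull_algebraMap hs]

/-- The extension of the bracket of `θ` along `s`, as a Poisson structure. -/
def extendedPoissonStructure [SmoothOfRelativeDimension 2 (S ↘ SpecC)]
    (hs : s ≫ π = (puncture hx).ι)
    (hinj : ∀ V, Function.Injective (pull s V))
    (hex : ∀ (V : Z.Opens) (f g : Γ(Z, V)), ∃ k, pull s V k = θ.bracket (pull s V f) (pull s V g)) :
    PoissonStructure Z where
  -- Each identity is checked after the injective pullback along s, where it is an identity for θ.
  bracket V := LinearMap.mk₂ ℂ (extendedBracket hex V)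
    (fun f f' g ↦ hinj V (by simp only [map_add, pull_extendedBracket, LinearMap.add_apply]))
    (fun c f g ↦ hinj V (by
      simp only [pull_smul hs, pull_extendedBracket, map_smul, LinearMap.smul_apply]))
    (fun f g g' ↦ hinj V (by simp only [map_add, pull_extendedBracket]))
    (fun c f g ↦ hinj V (by simp only [pull_smul hs, pull_extendedBracket, map_smul]))
  restrict_bracket h f g := hinj _ (by
    simp only [LinearMap.mk₂_apply, pull_restrict, pull_extendedBracket]
    exact θ.restrict_bracket _ _ _)
  skew V f g := hinj V (by
    simp only [LinearMap.mk₂_apply, map_neg, pull_extendedBracket]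
    exact θ.bracket_skew _ _)
  leibniz_left V f g h := hinj V (by
    simp only [LinearMap.mk₂_apply, map_add, map_mul, pull_extendedBracket]
    exact θ.bracket_mul_left _ _ _)
  leibniz_right V f g h := hinj V (by
    simp only [LinearMap.mk₂_apply, map_add, map_mul, pull_extendedBracket]
    exact θ.bracket_mul_right _ _ _)
  jacobi V f g h := hinj V (by
    simp only [LinearMap.mk₂_apply, map_add, map_zero, pull_extendedBracket]
    exact θ.jacobi _ _ _)

theorem exists_isLift [SmoothOfRelativeDimension 2 (S ↘ SpecC)] (hπ : IsBlowupAt x hx π) (hθ : θ.VanishesAt x) :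
    ∃ τ : PoissonStructure Z, IsLift π θ τ := by
  obtain ⟨s, hs⟩ := hπ.exists_section
  refine ⟨extendedPoissonStructure hs (hπ.pull_injective hs)
    (fun V f g ↦ exists_pull_eq_bracket hπ hs hθ f g), fun U f g ↦ hπ.pull_injective hs _ ?_⟩
  refine Eq.trans ?_ (pull_extendedBracket (s := s) (θ := θ) _ _ _ _).symm
  rw [θ.bilinear_apply, ← Scheme.Hom.appLE_eq_app, pull_appLE s hs le_rfl,
    pull_appLE s hs le_rfl, pull_appLE s hs le_rfl, θ.restrict_bracket]

end Extension

end

end PoissonSurface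

end

theorem corollary2p2
    (S : Scheme.{0}) [S.Over PoissonSurface.SpecC]
    [SmoothOfRelativeDimension 2 (S ↘ PoissonSurface.SpecC)]
    [IsSeparated (S ↘ PoissonSurface.SpecC)] [QuasiCompact (S ↘ PoissonSurface.SpecC)]
    (θ : PoissonSurface.AnticanonicalSection S)
    (x : S) (hx : IsClosed {x})
    (Z : Scheme.{0}) [Z.Over PoissonSurface.SpecC] (π : Z ⟶ S) [π.IsOver PoissonSurface.SpecC]
    (hπ : PoissonSurface.IsBlowupAt x hx π) :
    (∃ τ : PoissonSurface.PoissonStructure Z, PoissonSurface.IsLift π θ τ) ↔ θ.VanishesAt x :=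
  ⟨fun ⟨τ, hτ⟩ ↦ PoissonSurface.vanishesAt_of_isLift hx hπ θ τ hτ,
    PoissonSurface.exists_isLift hπ⟩
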